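/- **Setting.** A graph $G$ on a standard Borel space $X$ is *Borel* if its edge set is a Borel subset of $X\times X$. A probability measure $\mu$ on $X$ is *invariant* for $G$ if there are a countable group $\Gamma$ with a symmetric generating system $\Sigma$ and a $\mu$-preserving Borel action of $\Gamma$ on $X$ such that distinct $x,y$ are adjacent in $G$ iff $y=\sigma x$ for some $\sigma\in\Sigma$. The graph is *ergodic* if every Borel union of components of $G$ is $\mu$-null or $\mu$-conull. For $\varepsilon>0$ and an integer $K\ge 1$, $(G,X,\mu)$ is *$(\varepsilon,K)$-hyperfinite* if there is a Borel set $S\subset X$ with $\mu(S)<\varepsilon$ such that all components of the induced graph $G_{X\setminus S}$ have at most $K$ vertices; $(G,X,\mu)$ of bounded degrees is *$\mu$-hyperfinite* if for every $\varepsilon>0$ it is $(\varepsilon,K)$-hyperfinite for some $K\ge1$; it is *$\mu$-uniformly hyperfinite* if for every $\varepsilon>0$ there is $K\ge 1$ such that for every Borel set $A\subset X$ of positive measure the induced graph $(G_A,A,\mu_A)$, where $\mu_A(B)=\mu(B)/\mu(A)$, is $(\varepsilon,K)$-hyperfinite. **Construction.** Let $\alpha\in\mathbb R$ be irrational, $X=\mathbb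 R/\mathbb Z$ with its Lebesgue probability measure $\mu$, and let $\mathcal H$ be the graph on $X$ in which $x,y$ are adjacent iff $y=x+\alpha$ or $x=y+\alpha$. Let $T_1,T_2,\dots$ be finite $3$-regular graphs with $|V(T_1)|<|V(T_2)|<\cdots$ forming an expander sequence: there is $c>0$ such that for all $n$ and all $S\subset V(T_n)$ with $|S|\le\frac12|V(T_n)|$ at least $c|S|$ edges of $T_n$ join $S$ to its complement. Fix vertices $t_n\in V(T_n)$. A *marker sequence* is a sequence of Borel sets $Y_1,Y_2,\dots\subset X$ such that for each $n$ * there is an integer $C_n>0$ such that every $x\in X$ is at $\mathcal H$-distance at most $C_n$ from some $y\in Y_n$, and * $\mu(Y_n)\le \dfrac{1}{2^n|V(T_n)|}$. Given a marker sequence, let $\hat X=X\sqcup\bigsqcup_{n\ge1}(Y_n\times V(T_n))$, let $\nu$ be the Borel measure on $\hat X$ with $\nu(A)=\mu(A)$ for Borel $A\subset X$ and $\nu(B\times\{p\})=\mu(B)$ for Borel $B\subset Y_n$ and $p\in V(T_n)$, and let $\hat\mu=\nu/\nu(\hat X)$. Let $\hat{\mathcal H}$ be the graph on $\hat X$ that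 is $\mathcal H$ on $X$, is a copy of $T_n$ on $\{s\}\times V(T_n)$ for each $n\ge1$ and $s\in Y_n$, has an edge between $s$ and $(s,t_n)$ for each $n\ge 1$ and $s\in Y_n$, and has no other edges. **Lemma (Example 1).** Marker sequences exist, even with pairwise disjoint $Y_n$. For every marker sequence for which the number of $n$ with $x\in Y_n$ is bounded uniformly in $x\in X$ (for instance, with pairwise disjoint $Y_n$), $\hat{\mathcal H}$ is a Borel graph of bounded vertex degrees on the standard Borel space $\hat X$, $\hat\mu$ is an invariant probability measure for it, $(\hat{\mathcal H},\hat X,\hat\mu)$ is ergodic, and it is $\hat\mu$-hyperfinite but not $\hat\mu$-uniformly hyperfinite. -/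

import Mathlib

open MeasureTheory Set
open scoped ENNReal

/-! ### Borel graphs and measured graphs -/

/-- A Borel graph on a standard Borel space: the edge relation is a Borel subset of `X × X`
(symmetry and irreflexivity are part of `SimpleGraph`). -/
structure IsBorelGraph {X : Type*} [MeasurableSpace X] (G : SimpleGraph X) : Prop where
  standardBorel : StandardBorelSpace X
  measurableSet_adj : MeasurableSet {p : X × X | G.Adj p.1 p.2}

/-- All vertex degrees are bounded by one finite number. -/
def HasBoundedDegrees {X : Type*} (G : SimpleGraph X) : Prop :=
  ∃ d : ℕ, ∀ x : X, (G.neighborSet x).encard ≤ d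

/-- `μ` is an invariant measure of the graph `G`: there are a countable group `Γ` with a symmetric
generating system `S` and a Borel action of `Γ` that preserves `μ` such that distinct points
`x, y` are adjacent in `G` exactly when `y = σ • x` for some `σ ∈ S`. -/
def IsInvariantMeasure {X : Type*} [MeasurableSpace X] (G : SimpleGraph X) (μ : Measure X) :
    Prop :=
  ∃ (Γ : Type) (_ : Group Γ) (_ : Countable Γ) (_ : MulAction Γ X) (S : Set Γ),
    (∀ σ ∈ S, σ⁻¹ ∈ S) ∧ Subgroup.closure S = ⊤ ∧
    (∀ x y : X, G.Adj x y ↔ x ≠ y ∧ ∃ σ ∈ S, y = σ • x) ∧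
    ∀ γ : Γ, MeasurePreserving (fun x : X => γ • x) μ μ

/-- The orbit equivalence relation of `G` is ergodic: every Borel set that is a union of
components of `G` is null or conull. -/
def IsErgodicGraph {X : Type*} [MeasurableSpace X] (G : SimpleGraph X) (μ : Measure X) : Prop :=
  ∀ A : Set X, MeasurableSet A → (∀ x y : X, G.Reachable x y → (x ∈ A ↔ y ∈ A)) →
    μ A = 0 ∨ μ Aᶜ = 0

/-! ### Hyperfiniteness and uniform hyperfiniteness -/

/-- `(ε, K)`-hyperfiniteness: after removing a Borel set of measure less than `ε`, all components
of the induced graph have at most `K` vertices. -/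
def IsEpsHyperfinite {X : Type*} [MeasurableSpace X] (G : SimpleGraph X) (μ : Measure X)
    (ε : ℝ) (K : ℕ) : Prop :=
  ∃ T : Set X, MeasurableSet T ∧ μ T < ENNReal.ofReal ε ∧
    ∀ c : (G.induce Tᶜ).ConnectedComponent, c.supp.encard ≤ K

/-- `μ`-hyperfiniteness of a measured graph of bounded degrees. -/
def IsMuHyperfinite {X : Type*} [MeasurableSpace X] (G : SimpleGraph X) (μ : Measure X) : Prop :=
  ∀ ε : ℝ, 0 < ε → ∃ K : ℕ, 1 ≤ K ∧ IsEpsHyperfinite G μ ε K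

/-- The normalized restriction `B ↦ μ(B) / μ(A)`, as a measure on the subspace `A`. -/
noncomputable def normalizedRestriction {X : Type*} [MeasurableSpace X] (μ : Measure X)
    (A : Set X) : Measure A :=
  (μ A)⁻¹ • μ.comap (Subtype.val : A → X)

/-- `(ε, K)`-uniform hyperfiniteness: the induced measured graph on every Borel set of positive
measure is `(ε, K)`-hyperfinite. -/
def IsEpsUniformlyHyperfinite {X : Type*} [MeasurableSpace X] (G : SimpleGraph X)
    (μ : Measure X) (ε : ℝ) (K : ℕ) : Prop :=
  ∀ A : Set X, MeasurableSet A → 0 < μ A →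
    IsEpsHyperfinite (G.induce A) (normalizedRestriction μ A) ε K

/-- `μ`-uniform hyperfiniteness. -/
def IsMuUniformlyHyperfinite {X : Type*} [MeasurableSpace X] (G : SimpleGraph X)
    (μ : Measure X) : Prop :=
  ∀ ε : ℝ, 0 < ε → ∃ K : ℕ, 1 ≤ K ∧ IsEpsUniformlyHyperfinite G μ ε K

/-! ### The ingredients: expanders, the rotation graph, marker sets -/

/-- A sequence of finite graphs with edge expansion uniformly bounded away from zero:
every set `S` of at most half of the vertices has at least `c * |S|` edges leaving it. -/
def IsExpanderSequence {V : ℕ → Type*} [∀ n, Fintype (V n)] (T : ∀ n, SimpleGraph (V n)) :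
    Prop :=
  ∃ c : ℝ, 0 < c ∧ ∀ (n : ℕ) (S : Finset (V n)), 2 * S.card ≤ Fintype.card (V n) →
    c * (S.card : ℝ) ≤
      ({e : V n × V n | e.1 ∈ S ∧ e.2 ∉ S ∧ (T n).Adj e.1 e.2}.ncard : ℝ)

/-- The graph of the rotation by `α` of the circle `ℝ / ℤ`: distinct points `x`, `y` are adjacent
when `y = x + α` or `x = y + α`. -/
def rotationGraph (α : ℝ) : SimpleGraph UnitAddCircle :=
  SimpleGraph.fromRel fun x y => y = x + (α : UnitAddCircle)

/-- Marker sets for the rotation by `α` and the finite vertex sets `V 0, V 1, …`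
(the index `n` stands for the `n + 1`-st term of a sequence that starts with `1`). -/
structure IsMarkerSequence (α : ℝ) (V : ℕ → Type*) [∀ n, Fintype (V n)]
    (Y : ℕ → Set UnitAddCircle) : Prop where
  measurableSet : ∀ n, MeasurableSet (Y n)
  syndetic : ∀ n, ∃ C : ℕ, 0 < C ∧ ∀ x : UnitAddCircle, ∃ y ∈ Y n,
    (rotationGraph α).edist x y ≤ C
  volume_le : ∀ n, volume (Y n) ≤ ((2 : ℝ≥0∞) ^ (n + 1) * (Fintype.card (V n) : ℝ≥0∞))⁻¹

/-! ### Attaching copies of finite graphs along a sequence of sets -/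

/-- The disjoint union `X ∪ (Y 0 × V 0) ∪ (Y 1 × V 1) ∪ …`. -/
def AttachedSpace {X : Type*} (Y : ℕ → Set X) (V : ℕ → Type*) : Type _ :=
  X ⊕ (Σ n : ℕ, (Y n) × V n)

namespace AttachedSpace

variable {X : Type*} {Y : ℕ → Set X} {V : ℕ → Type*}

/-- A point of the original space. -/
def base (x : X) : AttachedSpace Y V := Sum.inl x

/-- The point `(s, p)` of `Y n × V n`. -/
def copy (n : ℕ) (s : Y n) (p : V n) : AttachedSpace Y V := Sum.inr ⟨n, (s, p)⟩

/-- The disjoint union σ-algebra; the vertex sets `V n` are discrete. -/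
instance [MeasurableSpace X] : MeasurableSpace (AttachedSpace Y V) :=
  letI : ∀ n, MeasurableSpace (V n) := fun _ => ⊤
  inferInstanceAs (MeasurableSpace (X ⊕ (Σ n : ℕ, (Y n) × V n)))

variable (Y V) in
/-- The measure that is `μ` on `X` and, for each `n` and `p : V n`, the restriction of `μ` to
`Y n` on `Y n × {p}`. -/
noncomputable def rawMeasure [MeasurableSpace X] (μ : Measure X) [∀ n, Fintype (V n)] :
    Measure (AttachedSpace Y V) :=
  μ.map base + Measure.sum fun n : ℕ => ∑ p : V n,
    (μ.comap (Subtype.val : Y n → X)).map fun s => copy n s p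

variable (Y V) in
/-- The normalization of `rawMeasure` to total mass one. -/
noncomputable def measure [MeasurableSpace X] (μ : Measure X) [∀ n, Fintype (V n)] :
    Measure (AttachedSpace Y V) :=
  (rawMeasure Y V μ univ)⁻¹ • rawMeasure Y V μ

/-- The edges of the attached graph, each in at least one orientation: those of `H` on `X`, the
edge from each `s ∈ Y n` to `(s, t n)`, and those of a copy of `T n` on each `{s} × V n`. -/
inductive EdgeRel (H : SimpleGraph X) (T : ∀ n, SimpleGraph (V n)) (t : ∀ n, V n) :
    AttachedSpace Y V → AttachedSpace Y V → Prop
  | ofBase (x y : X) : H.Adj x y → EdgeRel H T t (base x) (base y)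
  | link (n : ℕ) (s : Y n) : EdgeRel H T t (base (s : X)) (copy n s (t n))
  | ofCopy (n : ℕ) (s : Y n) (p q : V n) : (T n).Adj p q →
      EdgeRel H T t (copy n s p) (copy n s q)

variable (Y) in
/-- The graph on the attached space: `H` on `X`, with a copy of `T n` on `{s} × V n` for every `n`
and every `s ∈ Y n`, joined to `s` by an edge at `(s, t n)`. -/
def graph (H : SimpleGraph X) (T : ∀ n, SimpleGraph (V n)) (t : ∀ n, V n) :
    SimpleGraph (AttachedSpace Y V) :=
  SimpleGraph.fromRel (EdgeRel H T t)

end AttachedSpace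

/-! Hyperfiniteness allows a small error set anywhere in the space, while uniform hyperfiniteness
also tests sets of tiny measure. The copies of level `n` have total mass at most `2⁻¹ ^ (n + 1)`, so
for hyperfiniteness all high levels can be thrown away. Yet each single level has positive measure,
and its induced graph is a disjoint union of expanders of size `|V n|`; no `K` serves all levels.

Hyperfinite: delete `Y M` from the base and all copies of level at least `M`. Since `Y M` is
syndetic, orbits break into segments of bounded length, and each point carries boundedly many
vertices of lower level (`exists_encard_supp_le`).

Not uniformly hyperfinite: a set of small relative measure in a level takes few vertices from some
copy (`exists_card_lt_of_normalizedRestriction_lt`), and an expander without few vertices keeps a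
component with more than a quarter of all vertices (`false_of_expansion_of_small_components`).

Invariance: the edges come from the rotation on the base and from involutions that permute the
fibers of `proj`. The measure is the integral of the counting measures of the fibers
(`rawMeasure_eq_lintegral`), so the involutions preserve it.

Ergodicity: copies are connected and joined to the base, so a union of components is determined by
its trace on the circle, where the irrational rotation is ergodic. Markers: small disjoint open arcs
are syndetic, by density of orbits and compactness. -/

/-! ### Borel structure and measure of the attached space -/

/-- A measurable space that embeds measurably into a standard Borel space is standard Borel. -/
theorem MeasurableEmbedding.standardBorelSpace {X Z : Type*} [MeasurableSpace X]
    [MeasurableSpace Z] [StandardBorelSpace Z] {f : X → Z} (hf : MeasurableEmbedding f) :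
    StandardBorelSpace X := by
  have := hf.measurableSet_range.standardBorel
  let e := hf.equivRange
  let := upgradeStandardBorel (range f)
  -- The Polish topology of the range is pulled back along `e`, which makes `e` a homeomorphism.
  let : TopologicalSpace X := .induced e ‹UpgradedStandardBorel (range f)›.toTopologicalSpace
  have hX : BorelSpace X := by
    refine ⟨?_⟩
    rw [← (MeasurableEquiv.measurableEmbedding e).comap_eq, borel_comap]
    congr 1
    exact eq_borel_upgradeStandardBorel (range f)
  have : PolishSpace X :=
    (Homeomorph.mk e.toEquiv continuous_induced_dom
      (continuous_induced_rng.2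
        (by simpa [Function.comp_def] using continuous_id'))).isClosedEmbedding.polishSpace
  infer_instance

theorem indicator_one_congr {X Z : Type*} {A : Set X} {B : Set Z} {a : X} {b : Z}
    (h : a ∈ A ↔ b ∈ B) : A.indicator (1 : X → ℝ≥0∞) a = B.indicator 1 b := by
  by_cases ha : a ∈ A
  · simp [ha, h.1 ha]
  · simp [ha, mt h.2 ha]

namespace AttachedSpace

variable {X : Type*} {Y : ℕ → Set X} {V : ℕ → Type*}

@[elab_as_elim]
theorem rec' {P : AttachedSpace Y V → Prop} (hb : ∀ x, P (base x))
    (hc : ∀ n s p, P (copy n s p)) (z : AttachedSpace Y V) : P z := by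
  rcases z with x | ⟨n, s, p⟩
  · exact hb x
  · exact hc n s p

/-- The map that collapses each attached copy to the point where it is attached. -/
def proj : AttachedSpace Y V → X :=
  Sum.elim id fun z => z.2.1

@[simp] theorem proj_base (x : X) : proj (base x : AttachedSpace Y V) = x := rfl

@[simp] theorem proj_copy (n : ℕ) (s : Y n) (p : V n) : proj (copy n s p) = (s : X) := rfl

@[simp] theorem base_ne_copy (x : X) (n : ℕ) (s : Y n) (p : V n) :
    (base x : AttachedSpace Y V) ≠ copy n s p := Sum.inl_ne_inr

@[simp] theorem copy_ne_base (x : X) (n : ℕ) (s : Y n) (p : V n) :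
    copy n s p ≠ (base x : AttachedSpace Y V) := Sum.inr_ne_inl

theorem base_injective : Function.Injective (base : X → AttachedSpace Y V) := Sum.inl_injective

@[simp] theorem base_inj {x y : X} : (base x : AttachedSpace Y V) = base y ↔ x = y :=
  base_injective.eq_iff

@[simp] theorem copy_inj {n : ℕ} {s s' : Y n} {p p' : V n} :
    copy n s p = copy n s' p' ↔ s = s' ∧ p = p' := by
  simp only [copy]
  constructor
  · intro h
    have h' := eq_of_heq (Sigma.mk.inj (Sum.inr_injective h)).2
    exact Prod.mk.inj h'
  · rintro ⟨rfl, rfl⟩; rfl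

theorem eq_of_copy_eq {n m : ℕ} {s : Y n} {s' : Y m} {p : V n} {p' : V m}
    (h : copy n s p = copy m s' p') : n = m :=
  (Sigma.mk.inj (Sum.inr_injective h)).1

/-- The points `x` over which `A` contains the vertex `p` of the attached copy of level `n`. -/
def slice (A : Set (AttachedSpace Y V)) (n : ℕ) (p : V n) : Set X :=
  {x | ∃ h : x ∈ Y n, copy n ⟨x, h⟩ p ∈ A}

theorem image_copy_preimage (A : Set (AttachedSpace Y V)) (n : ℕ) (p : V n) :
    Subtype.val '' ((fun s : Y n => copy n s p) ⁻¹' A) = slice A n p := by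
  ext x
  simp [slice]

/-- The left side is visibly unchanged when the fiber is permuted; the right side integrates to
`rawMeasure`. -/
theorem tsum_fiber [∀ n, Fintype (V n)] (A : Set (AttachedSpace Y V)) (x : X) :
    ∑' z, (A ∩ proj ⁻¹' {x}).indicator (1 : AttachedSpace Y V → ℝ≥0∞) z =
      (base ⁻¹' A : Set X).indicator 1 x +
        ∑' n, ∑ p, (slice A n p).indicator (1 : X → ℝ≥0∞) x := by
  have h1 : ∑' z, (A ∩ proj ⁻¹' {x}).indicator (1 : AttachedSpace Y V → ℝ≥0∞) z =
      ∑' y : X, (A ∩ proj ⁻¹' {x}).indicator (1 : AttachedSpace Y V → ℝ≥0∞) (base y) +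
      ∑' w : (Σ n : ℕ, (Y n) × V n),
        (A ∩ proj ⁻¹' {x}).indicator (1 : AttachedSpace Y V → ℝ≥0∞) (copy w.1 w.2.1 w.2.2) :=
    ENNReal.summable.tsum_sum ENNReal.summable
  rw [h1, ENNReal.tsum_sigma']
  congr 1
  · rw [tsum_eq_single x]
    · exact indicator_one_congr (by simp)
    · intro y hy
      simp [hy]
  · congr 1 with n
    rw [ENNReal.tsum_prod', ENNReal.tsum_comm, tsum_fintype]
    refine Finset.sum_congr rfl fun p _ => ?_
    by_cases h : x ∈ Y n
    · rw [tsum_eq_single ⟨x, h⟩]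
      · exact indicator_one_congr (by simp [slice, h])
      · intro s hs
        have : (s : X) ≠ x := fun h' => hs (Subtype.ext h')
        simp [this]
    · have : ∀ s : Y n, (s : X) ≠ x := fun s h' => h (h' ▸ s.2)
      simp [slice, h, this]

variable [MeasurableSpace X]

theorem measurable_base : Measurable (base : X → AttachedSpace Y V) := by
  let _ : ∀ n, MeasurableSpace (V n) := fun _ => ⊤
  exact measurable_inl

theorem measurable_copy (n : ℕ) (p : V n) :
    Measurable (fun s : Y n => (copy n s p : AttachedSpace Y V)) := by
  let _ : ∀ n, MeasurableSpace (V n) := fun _ => ⊤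
  have h1 : Measurable fun w : (Y n) × V n => (⟨n, w⟩ : Σ n : ℕ, (Y n) × V n) :=
    fun s hs => MeasurableSpace.measurableSet_iInf.1 hs n
  exact measurable_inr.comp (h1.comp (measurable_id.prodMk measurable_const))

/-- Each `V n` is finite and discrete, so measurability on `Y n × V n` can be tested on the pieces
`Y n × {p}`. -/
theorem measurable_of_base_copy [∀ n, Fintype (V n)] {Z : Type*} [MeasurableSpace Z]
    {f : AttachedSpace Y V → Z} (hb : Measurable fun x => f (base x))
    (hc : ∀ n p, Measurable fun s : Y n => f (copy n s p)) : Measurable f := by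
  let _ : ∀ n, MeasurableSpace (V n) := fun _ => ⊤
  refine measurable_fun_sum hb ?_
  intro s hs
  refine MeasurableSpace.measurableSet_iInf.2 fun n => ?_
  have : Measurable fun q : (Y n) × V n => f (Sum.inr ⟨n, q⟩) :=
    measurable_from_prod_countable_left fun p => hc n p
  exact this hs

theorem measurableSet_iff [∀ n, Fintype (V n)] {A : Set (AttachedSpace Y V)} :
    MeasurableSet A ↔ MeasurableSet (base ⁻¹' A) ∧
      ∀ n p, MeasurableSet ((fun s : Y n => copy n s p) ⁻¹' A) := by
  refine ⟨fun h => ⟨measurable_base h, fun n p => measurable_copy n p h⟩, fun h => ?_⟩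
  have : Measurable (fun z => z ∈ A) :=
    measurable_of_base_copy (measurableSet_setOfPred.1 h.1)
      fun n p => measurableSet_setOfPred.1 (h.2 n p)
  exact measurableSet_setOfPred.2 this

theorem measurableSet_slice (hY : ∀ n, MeasurableSet (Y n)) {A : Set (AttachedSpace Y V)}
    (hA : MeasurableSet A) (n : ℕ) (p : V n) : MeasurableSet (slice A n p) := by
  rw [← image_copy_preimage]
  exact (hY n).subtype_image (measurable_copy n p hA)

variable [∀ n, Fintype (V n)]

theorem measurable_proj : Measurable (proj : AttachedSpace Y V → X) :=
  measurable_of_base_copy measurable_id fun _ _ => measurable_subtype_coe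

/-- Recording the projection together with the level and vertex (`none` on the base) injects the
space into the product of `X` with a countable discrete space. Images of Borel sets are countable
unions of Borel rectangles. -/
theorem standardBorelSpace [StandardBorelSpace X] (hY : ∀ n, MeasurableSet (Y n)) :
    StandardBorelSpace (AttachedSpace Y V) := by
  let _ : ∀ n, MeasurableSpace (V n) := fun _ => ⊤
  let _ : MeasurableSpace (Option (Σ n, V n)) := ⊤
  let f : AttachedSpace Y V → X × Option (Σ n, V n) := fun z =>
    (proj z, Sum.elim (fun _ => none) (fun w => some ⟨w.1, w.2.2⟩) z)
  have hf : Measurable f := by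
    refine measurable_proj.prodMk ?_
    refine measurable_of_base_copy ?_ fun n p => ?_
    · exact measurable_const (a := none)
    · exact measurable_const (a := some (⟨n, p⟩ : Σ n, V n))
  have hinj : Function.Injective f := by
    rintro (x | ⟨n, s, p⟩) (y | ⟨m, s', q⟩) h
    · exact congrArg Sum.inl (Prod.mk.inj h).1
    · simp [f] at h
    · simp [f] at h
    · simp only [f, Prod.mk.injEq, Sum.elim_inr, Option.some.injEq, Sigma.mk.injEq] at h
      obtain ⟨h1, rfl, h2⟩ := h
      obtain rfl := eq_of_heq h2
      obtain rfl : s = s' := Subtype.ext h1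
      rfl
  refine MeasurableEmbedding.standardBorelSpace (f := f) ⟨hinj, hf, fun {A} hA => ?_⟩
  have : f '' A = (base ⁻¹' A) ×ˢ {none} ∪
      ⋃ n, ⋃ p, slice A n p ×ˢ {some ⟨n, p⟩} := by
    ext ⟨x, o⟩
    simp only [mem_image, mem_union, mem_iUnion, mem_prod, mem_singleton_iff, mem_preimage]
    constructor
    · rintro ⟨z, hz, h⟩
      induction z using rec' with
      | hb y =>
        obtain ⟨rfl, rfl⟩ := Prod.mk.inj h
        exact .inl ⟨hz, rfl⟩
      | hc n s p =>
        obtain ⟨rfl, rfl⟩ := Prod.mk.inj h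
        exact .inr ⟨n, p, ⟨s.2, hz⟩, rfl⟩
    · rintro (⟨hx, rfl⟩ | ⟨n, p, ⟨h, hx⟩, rfl⟩)
      · exact ⟨_, hx, rfl⟩
      · exact ⟨_, hx, rfl⟩
  rw [this]
  refine ((measurable_base hA).prod (measurableSet_singleton _)).union ?_
  exact .iUnion fun n => .iUnion fun p =>
    (measurableSet_slice hY hA n p).prod (measurableSet_singleton _)

theorem rawMeasure_apply (μ : Measure X) (hY : ∀ n, MeasurableSet (Y n))
    {A : Set (AttachedSpace Y V)} (hA : MeasurableSet A) :
    rawMeasure Y V μ A = μ (base ⁻¹' A) + ∑' n, ∑ p, μ (slice A n p) := by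
  simp only [rawMeasure, Measure.add_apply, Measure.map_apply measurable_base hA,
    Measure.sum_apply _ hA, Measure.coe_finsetSum, Finset.sum_apply]
  congr 2 with n
  refine Finset.sum_congr rfl fun p _ => ?_
  rw [Measure.map_apply (measurable_copy n p) hA, comap_subtype_coe_apply (hY n),
    image_copy_preimage]

/-- The integrand counts the points of `A` over `x`; sums and integral are exchanged by monotone
convergence. -/
theorem rawMeasure_eq_lintegral (μ : Measure X) (hY : ∀ n, MeasurableSet (Y n))
    {A : Set (AttachedSpace Y V)} (hA : MeasurableSet A) :
    rawMeasure Y V μ A =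
      ∫⁻ x, ∑' z, (A ∩ proj ⁻¹' {x}).indicator (1 : AttachedSpace Y V → ℝ≥0∞) z ∂μ := by
  simp only [tsum_fiber]
  have hm : ∀ n (p : V n), Measurable ((slice A n p).indicator (1 : X → ℝ≥0∞)) :=
    fun n p => measurable_one.indicator (measurableSet_slice hY hA n p)
  have hb : MeasurableSet (base ⁻¹' A) := measurable_base hA
  rw [rawMeasure_apply μ hY hA, lintegral_add_left (measurable_one.indicator hb),
    lintegral_indicator_one hb,
    lintegral_tsum fun n => (Finset.measurable_fun_sum _ fun p _ => hm n p).aemeasurable]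
  congr 2 with n
  rw [lintegral_finsetSum _ fun p _ => hm n p]
  exact Finset.sum_congr rfl fun p _ =>
    (lintegral_indicator_one (measurableSet_slice hY hA n p)).symm

/-- A Borel automorphism that permutes every fiber of `proj` preserves the measure. -/
theorem measurePreserving_of_proj_eq (μ : Measure X) (hY : ∀ n, MeasurableSet (Y n))
    (f : AttachedSpace Y V ≃ AttachedSpace Y V) (hf : Measurable f)
    (hproj : ∀ z, proj (f z) = proj z) :
    MeasurePreserving f (rawMeasure Y V μ) (rawMeasure Y V μ) := by
  refine ⟨hf, Measure.ext fun A hA => ?_⟩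
  rw [Measure.map_apply hf hA, rawMeasure_eq_lintegral μ hY hA,
    rawMeasure_eq_lintegral μ hY (hf hA)]
  congr 1 with x
  -- Since `f` maps each fiber to itself, reindexing the count of `A` over `x` by `f` gives that of
  -- its preimage.
  rw [← f.tsum_eq ((A ∩ proj ⁻¹' {x}).indicator 1)]
  congr 1 with z
  exact indicator_one_congr (by simp [hproj])

/-- A measure-preserving map of the base extends by the identity on the attached copies. -/
theorem measurePreserving_of_base (μ : Measure X) (hY : ∀ n, MeasurableSet (Y n))
    {g : X → X} (hg : MeasurePreserving g μ μ) {f : AttachedSpace Y V → AttachedSpace Y V}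
    (hb : ∀ x, f (base x) = base (g x)) (hc : ∀ n s p, f (copy n s p) = copy n s p) :
    MeasurePreserving f (rawMeasure Y V μ) (rawMeasure Y V μ) := by
  have hf : Measurable f := by
    refine measurable_of_base_copy ?_ fun n p => ?_
    · simpa only [hb, Function.comp_def] using measurable_base.comp hg.measurable
    · simpa only [hc] using measurable_copy n p
  refine ⟨hf, Measure.ext fun A hA => ?_⟩
  rw [Measure.map_apply hf hA, rawMeasure_apply μ hY hA, rawMeasure_apply μ hY (hf hA)]
  congr 1
  · rw [← hg.measure_preimage (measurable_base hA).nullMeasurableSet]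
    congr 1 with x
    simp [hb]
  · simp [slice, hc]

end AttachedSpace

/-! ### Invariance, Borelness and bounded degrees -/

/-- A graph whose edges are given by countably many measure-preserving Borel automorphisms is
invariant. -/
theorem isInvariantMeasure_of_family {X ι : Type*} [MeasurableSpace X] [Countable ι]
    {G : SimpleGraph X} {μ : Measure X} (f : ι → Equiv.Perm X)
    (hf : ∀ i, MeasurePreserving (f i) μ μ) (hf' : ∀ i, MeasurePreserving (f i).symm μ μ)
    (hadj : ∀ x y, G.Adj x y ↔ x ≠ y ∧ ∃ i, y = f i x ∨ x = f i y) :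
    IsInvariantMeasure G μ := by
  -- The acting group has to live in `Type`, whereas `ι` may lie in a higher universe.
  let e := equivShrink.{0} ι
  have : Countable (Shrink.{0} ι) := e.symm.injective.countable
  let φ : FreeGroup (Shrink.{0} ι) →* Equiv.Perm X := FreeGroup.lift fun i => f (e.symm i)
  have hφ : ∀ i, φ (FreeGroup.of (e i)) = f i := fun i => by simp [φ]
  refine ⟨FreeGroup (Shrink.{0} ι), inferInstance, Quot.mk_surjective.countable,
    MulAction.compHom X φ,
    {g | ∃ i, g = FreeGroup.of (e i) ∨ g = (FreeGroup.of (e i))⁻¹}, ?_, ?_, ?_, ?_⟩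
  · rintro _ ⟨i, rfl | rfl⟩
    · exact ⟨i, .inr rfl⟩
    · exact ⟨i, .inl (inv_inv _)⟩
  · rw [eq_top_iff, ← FreeGroup.closure_range_of]
    refine Subgroup.closure_mono ?_
    rintro _ ⟨i, rfl⟩
    exact ⟨e.symm i, .inl (by simp)⟩
  · intro x y
    rw [hadj]
    refine and_congr_right fun _ => ⟨?_, ?_⟩
    · rintro ⟨i, rfl | rfl⟩
      · exact ⟨_, ⟨i, .inl rfl⟩, by change _ = φ _ x; rw [hφ]⟩
      · exact ⟨_, ⟨i, .inr rfl⟩, by change _ = φ _ _; rw [map_inv, hφ]; simp⟩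
    · rintro ⟨_, ⟨i, rfl | rfl⟩, rfl⟩
      · exact ⟨i, .inl (by change φ _ x = _; rw [hφ])⟩
      · exact ⟨i, .inr (by change _ = f i (φ _ x); rw [map_inv, hφ]; simp)⟩
  · intro γ
    change MeasurePreserving (φ γ) μ μ
    induction γ using FreeGroup.induction_on with
    | C1 => simpa using MeasurePreserving.id μ
    | of i => simpa [φ] using hf _
    | inv_of i _ => simpa [φ] using hf' _
    | mul a b ha hb => simpa using ha.comp hb

/-- A graph with an invariant measure on a standard Borel space is Borel. -/
theorem IsInvariantMeasure.isBorelGraph {X : Type*} [MeasurableSpace X] [StandardBorelSpace X]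
    {G : SimpleGraph X} {μ : Measure X} (h : IsInvariantMeasure G μ) : IsBorelGraph G := by
  refine ⟨inferInstance, ?_⟩
  obtain ⟨Γ, _, _, _, S, -, -, hadj, hpres⟩ := h
  have : {p : X × X | G.Adj p.1 p.2} =
      (diagonal X)ᶜ ∩ ⋃ σ ∈ S, {p : X × X | p.2 = σ • p.1} := by
    ext ⟨x, y⟩
    simp [hadj]
  rw [this]
  refine measurableSet_diagonal.compl.inter ?_
  exact .biUnion (to_countable S) fun σ _ =>
    measurableSet_eq_fun measurable_snd ((hpres σ).measurable.comp measurable_fst)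

namespace AttachedSpace

variable {X : Type*} {Y : ℕ → Set X} {V : ℕ → Type*}

/-! ### Adjacency and degrees in the attached graph -/

section Adj

variable {H : SimpleGraph X} {T : ∀ n, SimpleGraph (V n)} {t : ∀ n, V n}

@[simp] theorem graph_adj_base_base {x y : X} :
    (graph Y H T t).Adj (base x) (base y) ↔ H.Adj x y := by
  simp only [graph, SimpleGraph.fromRel_adj]
  constructor
  · rintro ⟨-, h | h⟩
    · generalize hz : (base x : AttachedSpace Y V) = z at h
      generalize hw : (base y : AttachedSpace Y V) = w at h
      cases h with
      | ofBase x' y' h => rwa [base_injective hz, base_injective hw]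
      | link n s => simp at hw
      | ofCopy n s p q h => simp at hw
    · generalize hz : (base x : AttachedSpace Y V) = z at h
      generalize hw : (base y : AttachedSpace Y V) = w at h
      cases h with
      | ofBase x' y' h => rw [base_injective hz, base_injective hw]; exact h.symm
      | link n s => simp at hz
      | ofCopy n s p q h => simp at hw
  · exact fun h => ⟨by simpa using h.ne, .inl (.ofBase _ _ h)⟩

@[simp] theorem graph_adj_base_copy {x : X} {n : ℕ} {s : Y n} {p : V n} :
    (graph Y H T t).Adj (base x) (copy n s p) ↔ x = s ∧ p = t n := by
  simp only [graph, SimpleGraph.fromRel_adj]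
  constructor
  · rintro ⟨-, h | h⟩
    · generalize hz : (base x : AttachedSpace Y V) = z at h
      generalize hw : (copy n s p : AttachedSpace Y V) = w at h
      cases h with
      | ofBase x' y' h => simp at hw
      | link m s' =>
        obtain rfl := eq_of_copy_eq hw
        obtain ⟨rfl, rfl⟩ := copy_inj.1 hw
        exact ⟨base_injective hz, rfl⟩
      | ofCopy n s p q h => simp at hz
    · generalize hz : (base x : AttachedSpace Y V) = z at h
      generalize hw : (copy n s p : AttachedSpace Y V) = w at h
      cases h with
      | ofBase x' y' h => simp at hw
      | link m s' => simp at hz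
      | ofCopy n s p q h => simp at hz
  · rintro ⟨rfl, rfl⟩
    exact ⟨by simp, .inl (.link _ _)⟩

@[simp] theorem graph_adj_copy_base {x : X} {n : ℕ} {s : Y n} {p : V n} :
    (graph Y H T t).Adj (copy n s p) (base x) ↔ x = s ∧ p = t n := by
  rw [SimpleGraph.adj_comm, graph_adj_base_copy]

/-- A priori `p` and `q` have different types; the equality in the attached space avoids a transport
between `V n` and `V m`. -/
theorem edgeRel_copy_copy {n m : ℕ} {s : Y n} {s' : Y m} {p : V n} {q : V m}
    (h : EdgeRel H T t (copy n s p) (copy m s' q)) :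
    ∃ q', (T n).Adj p q' ∧ copy m s' q = copy n s q' := by
  generalize hz : (copy n s p : AttachedSpace Y V) = z at h
  generalize hw : (copy m s' q : AttachedSpace Y V) = w at h
  cases h with
  | ofBase x' y' h => simp at hw
  | link m s' => simp at hz
  | ofCopy k s'' p' q' h =>
    obtain rfl := eq_of_copy_eq hz
    obtain ⟨rfl, rfl⟩ := copy_inj.1 hz
    exact ⟨q', h, rfl⟩

theorem graph_adj_copy_copy_iff {n m : ℕ} {s : Y n} {s' : Y m} {p : V n} {q : V m} :
    (graph Y H T t).Adj (copy n s p) (copy m s' q) ↔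
      ∃ q', (T n).Adj p q' ∧ copy m s' q = copy n s q' := by
  simp only [graph, SimpleGraph.fromRel_adj]
  constructor
  · rintro ⟨-, h | h⟩
    · exact edgeRel_copy_copy h
    · obtain ⟨p', hp', h'⟩ := edgeRel_copy_copy h
      obtain rfl := eq_of_copy_eq h'
      obtain ⟨rfl, rfl⟩ := copy_inj.1 h'
      exact ⟨q, hp'.symm, rfl⟩
  · rintro ⟨q', h, h'⟩
    rw [h']
    exact ⟨by simpa using h.ne, .inl (.ofCopy _ _ _ _ h)⟩

@[simp] theorem graph_adj_copy_copy {n : ℕ} {s s' : Y n} {p q : V n} :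
    (graph Y H T t).Adj (copy n s p) (copy n s' q) ↔ s = s' ∧ (T n).Adj p q := by
  rw [graph_adj_copy_copy_iff]
  constructor
  · rintro ⟨q', h, h'⟩
    obtain ⟨rfl, rfl⟩ := copy_inj.1 h'
    exact ⟨rfl, h⟩
  · rintro ⟨rfl, h⟩
    exact ⟨q, h, rfl⟩

theorem exists_of_graph_adj_copy {n : ℕ} {s : Y n} {p : V n} {w : AttachedSpace Y V}
    (h : (graph Y H T t).Adj (copy n s p) w) :
    w = base (s : X) ∨ ∃ q, (T n).Adj p q ∧ w = copy n s q := by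
  induction w using rec' with
  | hb x => exact .inl (by rw [(graph_adj_copy_base.1 h).1])
  | hc m s' q => exact .inr (graph_adj_copy_copy_iff.1 h)

theorem exists_of_graph_adj_base {x : X} {w : AttachedSpace Y V}
    (h : (graph Y H T t).Adj (base x) w) :
    (∃ y, H.Adj x y ∧ w = base y) ∨ ∃ n, ∃ hx : x ∈ Y n, w = copy n ⟨x, hx⟩ (t n) := by
  induction w using rec' with
  | hb y => exact .inl ⟨y, graph_adj_base_base.1 h, rfl⟩
  | hc n s p =>
    obtain ⟨rfl, rfl⟩ := graph_adj_base_copy.1 h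
    exact .inr ⟨n, s.2, rfl⟩

theorem hasBoundedDegrees {d k D : ℕ} (hH : ∀ x, (H.neighborSet x).encard ≤ d)
    (hT : ∀ n p, ((T n).neighborSet p).encard ≤ k)
    (hD : ∀ x : X, {n : ℕ | x ∈ Y n}.encard ≤ D) :
    HasBoundedDegrees (graph Y H T t) := by
  -- A base point has at most `d + D` neighbours, a point of a copy at most `k + 1`; the sum covers
  -- both cases.
  refine ⟨d + D + (k + 1), fun z => ?_⟩
  push_cast
  induction z using rec' with
  | hb x =>
    refine le_add_right ?_
    have hsub : (graph Y H T t).neighborSet (base x) ⊆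
        base '' H.neighborSet x ∪ {w | ∃ n, ∃ hx : x ∈ Y n, w = copy n ⟨x, hx⟩ (t n)} := by
      intro w hw
      rcases exists_of_graph_adj_base hw with ⟨y, hy, rfl⟩ | h
      · exact .inl ⟨y, hy, rfl⟩
      · exact .inr h
    refine (encard_le_encard hsub).trans ((encard_union_le _ _).trans (add_le_add ?_ ?_))
    · exact (encard_image_le _ _).trans (hH x)
    · refine le_trans ?_ (hD x)
      -- A link neighbour of `x` is determined by its level; the value `0` on base points plays no
      -- role.
      refine encard_le_encard_of_injOn (f := Sum.elim (fun _ => 0) fun w => w.1) ?_ ?_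
      · rintro _ ⟨n, hx, rfl⟩
        exact hx
      · rintro _ ⟨n, hx, rfl⟩ _ ⟨m, hx', rfl⟩ h
        obtain rfl : n = m := h
        rfl
  | hc n s p =>
    refine le_add_left ?_
    have hsub : (graph Y H T t).neighborSet (copy n s p) ⊆
        copy n s '' (T n).neighborSet p ∪ {base (s : X)} := by
      intro w hw
      rcases exists_of_graph_adj_copy hw with rfl | ⟨q, hq, rfl⟩
      · exact .inr rfl
      · exact .inl ⟨q, hq, rfl⟩
    refine (encard_le_encard hsub).trans ((encard_union_le _ _).trans (add_le_add ?_ ?_))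
    · exact (encard_image_le _ _).trans (hT n p)
    · simp

end Adj

/-- The extension of a permutation of the base by the identity. -/
def basePerm (g : Equiv.Perm X) : Equiv.Perm (AttachedSpace Y V) :=
  Equiv.sumCongr g (Equiv.refl _)

/-- The map that acts on every copy of `V n` by `σ n` and fixes the base. -/
def copyPerm (σ : ∀ n, Equiv.Perm (V n)) : Equiv.Perm (AttachedSpace Y V) :=
  Equiv.sumCongr (Equiv.refl X)
    (Equiv.sigmaCongrRight fun n => Equiv.prodCongr (Equiv.refl (Y n)) (σ n))

section

open scoped Classical in
/-- The involution that exchanges `s` and `(s, t n)` for every `s ∈ Y n`. -/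
noncomputable def linkFun (t : ∀ n, V n) (n : ℕ) : AttachedSpace Y V → AttachedSpace Y V :=
  Sum.elim (fun x => if h : x ∈ Y n then copy n ⟨x, h⟩ (t n) else base x)
    fun w => if w.1 = n ∧ w.2.2 = t w.1 then base (w.2.1 : X) else copy w.1 w.2.1 w.2.2

theorem linkFun_base_of_mem (t : ∀ n, V n) {n : ℕ} {x : X} (h : x ∈ Y n) :
    linkFun t n (base x) = copy n ⟨x, h⟩ (t n) := dif_pos h

theorem linkFun_base_of_notMem (t : ∀ n, V n) {n : ℕ} {x : X} (h : x ∉ Y n) :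
    linkFun t n (base x : AttachedSpace Y V) = base x := dif_neg h

theorem linkFun_copy_self (t : ∀ n, V n) (n : ℕ) (s : Y n) :
    linkFun t n (copy n s (t n)) = base (s : X) := if_pos ⟨rfl, rfl⟩

theorem linkFun_copy_of_not (t : ∀ n, V n) {n m : ℕ} {s : Y m} {p : V m}
    (h : ¬ (m = n ∧ p = t m)) : linkFun t n (copy m s p) = copy m s p := if_neg h

theorem linkFun_involutive (t : ∀ n, V n) (n : ℕ) :
    Function.Involutive (linkFun t n : AttachedSpace Y V → AttachedSpace Y V) := by
  intro z
  induction z using rec' with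
  | hb x =>
    by_cases h : x ∈ Y n
    · rw [linkFun_base_of_mem t h, linkFun_copy_self]
    · rw [linkFun_base_of_notMem t h, linkFun_base_of_notMem t h]
  | hc m s p =>
    by_cases h : m = n ∧ p = t m
    · obtain ⟨rfl, rfl⟩ := h
      rw [linkFun_copy_self, linkFun_base_of_mem t s.2]
    · rw [linkFun_copy_of_not t h, linkFun_copy_of_not t h]

theorem proj_linkFun (t : ∀ n, V n) (n : ℕ) (z : AttachedSpace Y V) :
    proj (linkFun t n z) = proj z := by
  induction z using rec' with
  | hb x =>
    by_cases h : x ∈ Y n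
    · rw [linkFun_base_of_mem t h]; rfl
    · rw [linkFun_base_of_notMem t h]
  | hc m s p =>
    by_cases h : m = n ∧ p = t m
    · obtain ⟨rfl, rfl⟩ := h
      rw [linkFun_copy_self]; rfl
    · rw [linkFun_copy_of_not t h]

end

/-! ### Measurable generators and invariance -/

variable [MeasurableSpace X] [∀ n, Fintype (V n)]

theorem measurable_linkFun (hY : ∀ n, MeasurableSet (Y n)) (t : ∀ n, V n) (n : ℕ) :
    Measurable (linkFun t n : AttachedSpace Y V → AttachedSpace Y V) := by
  classical
  refine measurable_of_base_copy ?_ fun m p => ?_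
  · exact Measurable.dite (s := Y n) (measurable_copy n (t n))
      (measurable_base.comp measurable_subtype_coe) (hY n)
  · by_cases h : m = n ∧ p = t m
    · obtain ⟨rfl, rfl⟩ := h
      simpa only [linkFun_copy_self, Function.comp_def] using
        measurable_base.comp measurable_subtype_coe
    · simpa only [linkFun_copy_of_not t h] using measurable_copy m p

theorem measurable_copyPerm (σ : ∀ n, Equiv.Perm (V n)) :
    Measurable (copyPerm σ : AttachedSpace Y V → AttachedSpace Y V) :=
  measurable_of_base_copy measurable_base fun n p => measurable_copy n (σ n p)

theorem measurePreserving_copyPerm (μ : Measure X) (hY : ∀ n, MeasurableSet (Y n))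
    (σ : ∀ n, Equiv.Perm (V n)) :
    MeasurePreserving (copyPerm σ : Equiv.Perm (AttachedSpace Y V)) (rawMeasure Y V μ)
      (rawMeasure Y V μ) :=
  measurePreserving_of_proj_eq μ hY _ (measurable_copyPerm σ) fun z => by
    induction z using rec' <;> rfl

/-- The attached graph over the graph of a measure-preserving automorphism is invariant. -/
theorem isInvariantMeasure_graph {μ : Measure X} (hY : ∀ n, MeasurableSet (Y n))
    {g : Equiv.Perm X} (hg : MeasurePreserving g μ μ) (hg' : MeasurePreserving g.symm μ μ)
    {H : SimpleGraph X} (hH : ∀ x y, H.Adj x y ↔ x ≠ y ∧ (y = g x ∨ x = g y))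
    (T : ∀ n, SimpleGraph (V n)) (t : ∀ n, V n) :
    IsInvariantMeasure (graph Y H T t) (measure Y V μ) := by
  classical
  -- An edge `pq` of `T n` is realized by the transposition of `p` and `q` in all copies of level
  -- `n` at once. Pairs that are not edges give the identity, so that no generator creates a false
  -- adjacency.
  let σ (i : Σ n, V n × V n) : ∀ n, Equiv.Perm (V n) :=
    if (T i.1).Adj i.2.1 i.2.2 then
      Function.update (fun m => Equiv.refl (V m)) i.1 (Equiv.swap i.2.1 i.2.2)
    else fun m => Equiv.refl (V m)
  let f : Unit ⊕ ℕ ⊕ (Σ n, V n × V n) → Equiv.Perm (AttachedSpace Y V) :=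
    Sum.elim (fun _ => basePerm g)
      (Sum.elim (fun n => (linkFun_involutive t n).toPerm) fun i => copyPerm (σ i))
  have hlink : ∀ n, MeasurePreserving (linkFun_involutive (Y := Y) t n).toPerm
      (rawMeasure Y V μ) (rawMeasure Y V μ) := fun n =>
    measurePreserving_of_proj_eq μ hY _ (measurable_linkFun hY t n) (proj_linkFun t n)
  have hedge : ∀ z w, EdgeRel H T t z w → ∃ i, w = f i z ∨ z = f i w := by
    rintro _ _ (⟨x, y, h⟩ | ⟨n, s⟩ | ⟨n, s, p, q, h⟩)
    · rcases ((hH x y).1 h).2 with rfl | rfl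
      · exact ⟨.inl (), .inl rfl⟩
      · exact ⟨.inl (), .inr rfl⟩
    · exact ⟨.inr (.inl n), .inl (linkFun_base_of_mem t s.2).symm⟩
    · refine ⟨.inr (.inr ⟨n, p, q⟩), .inl ?_⟩
      change _ = copy n s (σ ⟨n, p, q⟩ n p)
      simp [σ, h]
  -- Conversely, a generator either fixes a point or moves it along an edge.
  have hmove : ∀ i z, z = f i z ∨ (graph Y H T t).Adj z (f i z) := by
    rintro (_ | n | ⟨n, p, q⟩) z
    · induction z using rec' with
      | hb x =>
        by_cases h : x = g x
        · exact .inl (congrArg base h)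
        · exact .inr (graph_adj_base_base.2 ((hH _ _).2 ⟨h, .inl rfl⟩))
      | hc m s r => exact .inl rfl
    · change z = linkFun t n z ∨ (graph Y H T t).Adj z (linkFun t n z)
      induction z using rec' with
      | hb x =>
        by_cases h : x ∈ Y n
        · rw [linkFun_base_of_mem t h]
          exact .inr (by simp)
        · exact .inl (linkFun_base_of_notMem t h).symm
      | hc m s r =>
        by_cases h : m = n ∧ r = t m
        · obtain ⟨rfl, rfl⟩ := h
          rw [linkFun_copy_self]
          exact .inr (by simp)
        · exact .inl (linkFun_copy_of_not t h).symm
    · induction z using rec' with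
      | hb x => exact .inl rfl
      | hc m s r =>
        change _ = copy m s (σ ⟨n, p, q⟩ m r) ∨
          (graph Y H T t).Adj _ (copy m s (σ ⟨n, p, q⟩ m r))
        by_cases h : (T n).Adj p q
        · by_cases hm : m = n
          · subst hm
            simp only [σ, h, if_true, Function.update_self, copy_inj, true_and,
              graph_adj_copy_copy]
            by_cases h1 : r = p
            · subst h1; simp [h]
            · by_cases h2 : r = q
              · subst h2; simp [h.symm]
              · exact .inl (Equiv.swap_apply_of_ne_of_ne h1 h2).symm
          · simp [σ, h, hm]
        · simp [σ, h]
  refine isInvariantMeasure_of_family f (fun i => .smul_measure ?_ _)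
    (fun i => .smul_measure ?_ _) fun z w => ⟨fun h => ⟨h.ne, ?_⟩, ?_⟩
  · rcases i with _ | n | i
    · exact measurePreserving_of_base μ hY hg (fun _ => rfl) fun _ _ _ => rfl
    · exact hlink n
    · exact measurePreserving_copyPerm μ hY _
  · rcases i with _ | n | i
    · exact measurePreserving_of_base μ hY hg' (fun _ => rfl) fun _ _ _ => rfl
    · exact hlink n
    · exact measurePreserving_copyPerm μ hY fun n => (σ i n).symm
  · rcases ((SimpleGraph.fromRel_adj _ _ _).1 h).2 with h | h
    · exact hedge z w h
    · obtain ⟨i, hi⟩ := hedge w z h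
      exact ⟨i, hi.symm⟩
  · rintro ⟨hne, i, rfl | rfl⟩
    · exact (hmove i z).resolve_left hne
    · exact ((hmove i w).resolve_left hne.symm).symm

end AttachedSpace

/-! ### Finite expanders -/

namespace SimpleGraph

variable {V : Type*} [Fintype V] {G : SimpleGraph V} {c : ℝ}

/-- A finite graph with positive edge expansion is connected. -/
theorem reachable_of_expansion (hc : 0 < c)
    (hexp : ∀ S : Finset V, 2 * S.card ≤ Fintype.card V →
      c * (S.card : ℝ) ≤ ({e : V × V | e.1 ∈ S ∧ e.2 ∉ S ∧ G.Adj e.1 e.2}.ncard : ℝ))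
    (p q : V) : G.Reachable p q := by
  classical
  have key : ∀ S : Finset V, 2 * S.card ≤ Fintype.card V →
      (∀ u v, G.Adj u v → (u ∈ S ↔ v ∈ S)) → S = ∅ := by
    intro S hS hclosed
    have h0 : {e : V × V | e.1 ∈ S ∧ e.2 ∉ S ∧ G.Adj e.1 e.2} = ∅ := by
      ext e
      simp only [mem_ofPred_eq, mem_empty_iff_false, iff_false]
      rintro ⟨h1, h2, h3⟩
      exact h2 ((hclosed _ _ h3).1 h1)
    have h := hexp S hS
    rw [h0, ncard_empty, Nat.cast_zero] at h
    have h' : (S.card : ℝ) ≤ 0 := by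
      by_contra hlt
      exact absurd h (not_le.2 (mul_pos hc (not_le.1 hlt)))
    exact Finset.card_eq_zero.1 (by exact_mod_cast le_antisymm h' (Nat.cast_nonneg _))
  let S : Finset V := Finset.univ.filter fun v => G.Reachable p v
  have hS : ∀ u v, G.Adj u v → (u ∈ S ↔ v ∈ S) := fun u v h => by
    simp only [S, Finset.mem_filter_univ]
    exact ⟨fun h' => h'.trans h.reachable, fun h' => h'.trans h.symm.reachable⟩
  have hp : p ∈ S := by simp [S]
  -- The component of `p` and its complement have no boundary edges and one of them has at most half
  -- of the vertices, hence is empty; it cannot be the one containing `p`.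
  by_cases h : 2 * S.card ≤ Fintype.card V
  · simp [key S h hS] at hp
  · have h2 : Sᶜ = ∅ := by
      refine key Sᶜ ?_ fun u v huv => by simp [hS u v huv]
      rw [Finset.card_compl]
      omega
    have hq : q ∈ S := by
      have : q ∉ Sᶜ := by simp [h2]
      simpa using this
    simpa [S] using hq

/-- Removing few vertices from a large expander cannot leave only small components. -/
theorem false_of_expansion_of_small_components [DecidableRel G.Adj] {K : ℕ} {R : Finset V}
    (hreg : G.IsRegularOfDegree 3)
    (hexp : ∀ S : Finset V, 2 * S.card ≤ Fintype.card V →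
      c * (S.card : ℝ) ≤ ({e : V × V | e.1 ∈ S ∧ e.2 ∉ S ∧ G.Adj e.1 e.2}.ncard : ℝ))
    (hc : 0 < c) (hR : (R.card : ℝ) < c / 12 * Fintype.card V)
    (hR' : 4 * R.card < Fintype.card V) (hK : 4 * K ≤ Fintype.card V)
    (hcomp : ∀ v ∉ R, ∃ C : Finset V, v ∈ C ∧ C.card ≤ K ∧ Disjoint C R ∧
      ∀ u ∈ C, ∀ w ∉ R, G.Adj u w → w ∈ C) : False := by
  classical
  -- Unions of components of the graph without `R` that have at most half of all vertices; a largest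
  -- one is taken.
  let P : Finset V → Prop := fun U =>
    Disjoint U R ∧ (∀ u ∈ U, ∀ w ∉ R, G.Adj u w → w ∈ U) ∧ 2 * U.card ≤ Fintype.card V
  obtain ⟨U, hU, hmax⟩ := (Finset.univ.filter P).exists_max_image Finset.card
    ⟨∅, by simp [P]⟩
  obtain ⟨hdisj, hclosed, hle⟩ : P U := by simpa using hU
  -- If `U` had less than a quarter of the vertices, some vertex would lie outside `U ∪ R`, and
  -- adding its component, of size at most a quarter, would contradict maximality.
  have hbig : Fintype.card V ≤ 4 * U.card := by
    by_contra! hlt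
    obtain ⟨v, hv⟩ : ∃ v, v ∉ U ∪ R := by
      by_contra! h
      have h1 : (U ∪ R).card = Fintype.card V := by
        rw [Finset.eq_univ_of_forall h, Finset.card_univ]
      have := Finset.card_union_le U R
      omega
    simp only [Finset.mem_union, not_or] at hv
    obtain ⟨C, hvC, hCK, hCR, hC⟩ := hcomp v hv.2
    have hP : P (U ∪ C) := by
      refine ⟨Finset.disjoint_union_left.2 ⟨hdisj, hCR⟩, ?_, ?_⟩
      · intro u hu w hw huw
        rcases Finset.mem_union.1 hu with hu | hu
        · exact Finset.mem_union_left _ (hclosed u hu w hw huw)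
        · exact Finset.mem_union_right _ (hC u hu w hw huw)
      · have := Finset.card_union_le U C
        omega
    have h1 := hmax (U ∪ C) (by simpa using hP)
    have h2 : U.card < (U ∪ C).card :=
      Finset.card_lt_card ⟨Finset.subset_union_left,
        fun h => hv.1 (h (Finset.mem_union_right _ hvC))⟩
    omega
  -- Every edge leaving `U` ends in `R`, and each vertex of `R` has degree 3.
  have hedges : {e : V × V | e.1 ∈ U ∧ e.2 ∉ U ∧ G.Adj e.1 e.2}.ncard ≤ R.card * 3 := by
    have hsub : {e : V × V | e.1 ∈ U ∧ e.2 ∉ U ∧ G.Adj e.1 e.2} ⊆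
        ↑(R.biUnion fun r => (G.neighborFinset r).image fun w => (w, r)) := by
      rintro ⟨u, w⟩ ⟨hu, hw, huw⟩
      have hwR : w ∈ R := by
        by_contra h
        exact hw (hclosed u hu w h huw)
      simp only [Finset.coe_biUnion, mem_iUnion, Finset.coe_image]
      exact ⟨w, hwR, u, by simpa using huw.symm, rfl⟩
    refine (ncard_le_ncard hsub (Finset.finite_toSet _)).trans ?_
    rw [ncard_coe_finset]
    refine Finset.card_biUnion_le_card_mul _ _ _ fun r _ => Finset.card_image_le.trans ?_
    rw [G.card_neighborFinset_eq_degree, hreg r]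
  have h1 := hexp U hle
  have h2 : ({e : V × V | e.1 ∈ U ∧ e.2 ∉ U ∧ G.Adj e.1 e.2}.ncard : ℝ) ≤ R.card * 3 := by
    exact_mod_cast hedges
  have h3 : (Fintype.card V : ℝ) ≤ 4 * U.card := by exact_mod_cast hbig
  -- `c|V|/4 ≤ c|U| ≤ 3|R| < c|V|/4`; this is the origin of `c / 12`.
  nlinarith [mul_le_mul_of_nonneg_left h3 hc.le]

end SimpleGraph

/-! ### The rotation graph -/

theorem rotationGraph_adj {α : ℝ} {x y : UnitAddCircle} :
    (rotationGraph α).Adj x y ↔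
      x ≠ y ∧ (y = x + (α : UnitAddCircle) ∨ x = y + (α : UnitAddCircle)) :=
  SimpleGraph.fromRel_adj _ _ _

theorem rotationGraph_edist_add_le_one (α : ℝ) (x : UnitAddCircle) :
    (rotationGraph α).edist x (x + (α : UnitAddCircle)) ≤ 1 := by
  by_cases h : x = x + (α : UnitAddCircle)
  · rw [← h]; simp
  · exact (SimpleGraph.edist_eq_one_iff_adj.2 (rotationGraph_adj.2 ⟨h, .inl rfl⟩)).le

theorem rotationGraph_edist_nsmul_le (α : ℝ) (x : UnitAddCircle) (n : ℕ) :
    (rotationGraph α).edist x (x + n • (α : UnitAddCircle)) ≤ n := by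
  induction n with
  | zero => simp
  | succ n ih =>
    rw [succ_nsmul, ← add_assoc, Nat.cast_succ]
    exact SimpleGraph.edist_triangle.trans
      (add_le_add ih (rotationGraph_edist_add_le_one α _))

theorem rotationGraph_edist_zsmul_le (α : ℝ) (x : UnitAddCircle) (k : ℤ) :
    (rotationGraph α).edist x (x + k • (α : UnitAddCircle)) ≤ k.natAbs := by
  obtain ⟨n, rfl | rfl⟩ := k.eq_nat_or_neg
  · simpa using rotationGraph_edist_nsmul_le α x n
  · have := rotationGraph_edist_nsmul_le α (x + (-(n : ℤ)) • (α : UnitAddCircle)) n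
    rw [SimpleGraph.edist_comm]
    simpa using this

theorem exists_zsmul_of_rotationGraph_edist_le {α : ℝ} {x y : UnitAddCircle} {C : ℕ}
    (h : (rotationGraph α).edist x y ≤ C) :
    ∃ k : ℤ, |k| ≤ C ∧ y = x + k • (α : UnitAddCircle) := by
  obtain ⟨w, hw⟩ := SimpleGraph.exists_walk_of_edist_ne_top
    (ne_top_of_le_ne_top (ENat.natCast_ne_top C) h)
  have hlen : w.length ≤ C := by
    rw [← hw] at h
    exact_mod_cast h
  suffices ∃ k : ℤ, |k| ≤ w.length ∧ y = x + k • (α : UnitAddCircle) by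
    obtain ⟨k, hk, rfl⟩ := this
    exact ⟨k, hk.trans (by exact_mod_cast hlen), rfl⟩
  clear hw hlen h
  induction w with
  | nil => exact ⟨0, by simp, by simp⟩
  | @cons x v y hadj w ih =>
    obtain ⟨k, hk, rfl⟩ := ih
    rw [SimpleGraph.Walk.length_cons]
    rcases (rotationGraph_adj.1 hadj).2 with rfl | rfl
    · refine ⟨k + 1, ?_, by rw [add_zsmul, one_zsmul]; abel⟩
      rw [abs_le] at hk ⊢
      push_cast
      omega
    · refine ⟨k - 1, ?_, by rw [sub_zsmul, one_zsmul]; abel⟩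
      rw [abs_le] at hk ⊢
      push_cast
      omega

/-- An orbit segment that avoids a syndetic set is short. -/
theorem abs_le_of_orbit_avoids {α : ℝ} {Z : Set UnitAddCircle} {C : ℕ}
    (hC : ∀ x, ∃ y ∈ Z, (rotationGraph α).edist x y ≤ C) {x : UnitAddCircle} {k : ℤ}
    (h : ∀ j ∈ uIcc 0 k, x + j • (α : UnitAddCircle) ∉ Z) : |k| ≤ 2 * C := by
  by_contra! hk
  rcases le_total 0 k with h0 | h0
  · obtain ⟨y, hy, hd⟩ := hC (x + (C : ℤ) • (α : UnitAddCircle))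
    obtain ⟨i, hi, rfl⟩ := exists_zsmul_of_rotationGraph_edist_le hd
    rw [add_assoc, ← add_zsmul] at hy
    refine h _ ?_ hy
    rw [uIcc_of_le h0]
    rw [abs_of_nonneg h0] at hk
    rw [abs_le] at hi
    constructor <;> omega
  · obtain ⟨y, hy, hd⟩ := hC (x + (-C : ℤ) • (α : UnitAddCircle))
    obtain ⟨i, hi, rfl⟩ := exists_zsmul_of_rotationGraph_edist_le hd
    rw [add_assoc, ← add_zsmul] at hy
    refine h _ ?_ hy
    rw [uIcc_of_ge h0]
    rw [abs_of_nonpos h0] at hk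
    rw [abs_le] at hi
    constructor <;> omega

/-- Countably many translates of `Z` cover the circle. -/
theorem volume_pos_of_syndetic {α : ℝ} {Z : Set UnitAddCircle} {C : ℕ}
    (hC : ∀ x, ∃ y ∈ Z, (rotationGraph α).edist x y ≤ C) : 0 < volume Z := by
  rw [pos_iff_ne_zero]
  intro h0
  have hcover : (univ : Set UnitAddCircle) ⊆
      ⋃ k : ℤ, (fun x => x + k • (α : UnitAddCircle)) ⁻¹' Z := by
    intro x _
    obtain ⟨y, hy, hd⟩ := hC x
    obtain ⟨k, -, rfl⟩ := exists_zsmul_of_rotationGraph_edist_le hd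
    exact mem_iUnion.2 ⟨k, hy⟩
  have h1 : volume (univ : Set UnitAddCircle) = 0 := by
    refine measure_mono_null hcover (measure_iUnion_null fun k => ?_)
    rw [measure_preimage_add_right, h0]
  simp at h1

/-- Orbits are dense, so the translates of `U` by multiples of `α` cover the circle; by compactness
finitely many suffice, and the largest multiple bounds the distance. -/
theorem exists_syndetic_of_isOpen {α : ℝ} (hα : Irrational α) {U : Set UnitAddCircle}
    (hU : IsOpen U) (hne : U.Nonempty) :
    ∃ C : ℕ, 0 < C ∧ ∀ x, ∃ y ∈ U, (rotationGraph α).edist x y ≤ C := by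
  have hd : DenseRange (· • (α : UnitAddCircle) : ℤ → UnitAddCircle) :=
    AddCircle.denseRange_zsmul_coe_iff.2 (by simpa using hα)
  obtain ⟨F, hF⟩ := isCompact_univ.elim_finite_subcover
    (fun k : ℤ => (fun x : UnitAddCircle => x + k • (α : UnitAddCircle)) ⁻¹' U)
    (fun k => hU.preimage (continuous_add_const _)) (by
      intro x _
      obtain ⟨u, hu⟩ := hne
      obtain ⟨k, hk⟩ := hd.exists_mem_open (hU.preimage (continuous_const_add x))
        ⟨-x + u, by simpa using hu⟩
      exact mem_iUnion.2 ⟨k, hk⟩)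
  refine ⟨F.sup Int.natAbs + 1, Nat.succ_pos _, fun x => ?_⟩
  obtain ⟨k, hk, hx⟩ := mem_iUnion₂.1 (hF (mem_univ x))
  refine ⟨_, hx, (rotationGraph_edist_zsmul_le α x k).trans ?_⟩
  exact_mod_cast (Finset.le_sup (f := Int.natAbs) hk).trans (Nat.le_succ _)

theorem isErgodicGraph_rotationGraph {α : ℝ} (hα : Irrational α) :
    IsErgodicGraph (rotationGraph α) volume := by
  intro A hA hinv
  have herg : Ergodic (· + (α : UnitAddCircle)) :=
    AddCircle.ergodic_add_right.2 (AddCircle.denseRange_zsmul_iff.1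
      (AddCircle.denseRange_zsmul_coe_iff.2 (by simpa using hα)))
  refine herg.toPreErgodic.measure_self_or_compl_eq_zero hA ?_
  ext x
  refine (hinv x _ ?_).symm
  exact SimpleGraph.reachable_of_edist_ne_top
    (ne_top_of_le_ne_top ENat.one_ne_top (rotationGraph_edist_add_le_one α x))

theorem encard_neighborSet_rotationGraph_le (α : ℝ) (x : UnitAddCircle) :
    ((rotationGraph α).neighborSet x).encard ≤ (2 : ℕ) := by
  have hsub : (rotationGraph α).neighborSet x ⊆
      {x + (α : UnitAddCircle), x - (α : UnitAddCircle)} := by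
    intro y hy
    rcases (rotationGraph_adj.1 hy).2 with h | h
    · exact .inl h
    · exact .inr (by simp [h])
  exact (encard_le_encard hsub).trans ((encard_insert_le _ _).trans
    (by rw [encard_singleton]; rfl))

/-- There are disjoint nonempty open subsets of the circle of arbitrarily small measures. -/
theorem exists_disjoint_isOpen_volume_le (b : ℕ → ℝ≥0∞) (hb : ∀ n, 0 < b n) :
    ∃ U : ℕ → Set UnitAddCircle, (∀ n, IsOpen (U n)) ∧ (∀ n, (U n).Nonempty) ∧
      (∀ n, volume (U n) ≤ b n) ∧ Pairwise fun m n => Disjoint (U m) (U n) := by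
  choose δ hδ0 hδ using fun n => ENNReal.lt_iff_exists_nnreal_btwn.1 (hb n)
  let l : ℕ → ℝ := fun n => 1 / ((n : ℝ) + 1)
  have hl : StrictAnti l := fun m n h => one_div_lt_one_div_of_lt (by positivity) (by gcongr)
  -- The gap between `1 / (n + 2)` and `1 / (n + 1)`, cut to length at most `δ n`. All lie in `(0,
  -- 1]`, where the projection to the circle is injective.
  let I : ℕ → Set ℝ := fun n => Ioo (l (n + 1)) (min (l n) (l (n + 1) + δ n))
  have hI : ∀ n, I n ⊆ Ioc 0 (0 + 1) := fun n x hx => by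
    have h1 : 0 < l (n + 1) := by positivity
    have h2 : l n ≤ l 0 := hl.antitone (Nat.zero_le n)
    have h3 : l 0 = 1 := by simp [l]
    have h4 := hx.2.le.trans (min_le_left _ _)
    exact ⟨h1.trans hx.1, by linarith⟩
  have hdisj : ∀ m n, m < n → Disjoint (I m) (I n) := fun m n hmn => by
    rw [Set.disjoint_left]
    intro x hm hn
    have h1 : x < l n := hn.2.trans_le (min_le_left _ _)
    have h2 : l n ≤ l (m + 1) := hl.antitone hmn
    exact absurd hm.1 (not_lt.2 (h1.le.trans h2))
  have hinj : InjOn ((↑) : ℝ → UnitAddCircle) (Ioc 0 (0 + 1)) :=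
    fun x hx y hy h => (AddCircle.coe_eq_coe_iff_of_mem_Ioc hx hy).1 h
  have hopen : ∀ n, IsOpen (((↑) : ℝ → UnitAddCircle) '' I n) :=
    fun n => QuotientAddGroup.isOpenMap_coe _ isOpen_Ioo
  have hdisj' : ∀ m n, m < n → Disjoint (((↑) : ℝ → UnitAddCircle) '' I m)
      (((↑) : ℝ → UnitAddCircle) '' I n) := fun m n h => by
    rw [Set.disjoint_left]
    rintro _ ⟨x, hx, rfl⟩ ⟨y, hy, hxy⟩
    obtain rfl := hinj (hI n hy) (hI m hx) hxy
    exact Set.disjoint_left.1 (hdisj m n h) hx hy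
  refine ⟨fun n => (↑) '' I n, hopen, fun n => ?_, fun n => ?_, fun m n hmn => ?_⟩
  · refine (nonempty_Ioo.2 (lt_min (hl n.lt_succ_self) ?_)).image _
    have : (0 : ℝ) < δ n := by exact_mod_cast hδ0 n
    linarith
  · rw [AddCircle.add_projection_respects_measure 1 0 (hopen n).measurableSet]
    have hsub : ((QuotientAddGroup.mk : ℝ → UnitAddCircle) ⁻¹' ((↑) '' I n) ∩ Ioc 0 (0 + 1)) ⊆
        Ioo (l (n + 1)) (l (n + 1) + δ n) := by
      rintro x ⟨⟨y, hy, hxy⟩, hx⟩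
      obtain rfl := hinj (hI n hy) hx hxy
      exact ⟨hy.1, hy.2.trans_le (min_le_right _ _)⟩
    refine (measure_mono hsub).trans ?_
    rw [Real.volume_Ioo]
    simpa using (hδ n).le
  · rcases lt_or_gt_of_ne hmn with h | h
    · exact hdisj' m n h
    · exact (hdisj' n m h).symm

namespace AttachedSpace

variable {X : Type*} {Y : ℕ → Set X} {V : ℕ → Type*}

/-! ### The total mass -/

section Mass

variable [MeasurableSpace X] [∀ n, Fintype (V n)] {μ : Measure X}

theorem rawMeasure_univ (hY : ∀ n, MeasurableSet (Y n)) :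
    rawMeasure Y V μ univ = μ univ + ∑' n, Fintype.card (V n) * μ (Y n) := by
  rw [rawMeasure_apply μ hY .univ]
  congr 2 with n
  simp [slice]

theorem one_le_rawMeasure_univ [IsProbabilityMeasure μ] (hY : ∀ n, MeasurableSet (Y n)) :
    1 ≤ rawMeasure Y V μ univ := by
  rw [rawMeasure_univ hY, measure_univ]
  exact le_self_add

theorem measure_le_rawMeasure [IsProbabilityMeasure μ] (hY : ∀ n, MeasurableSet (Y n))
    (A : Set (AttachedSpace Y V)) : measure Y V μ A ≤ rawMeasure Y V μ A := by
  rw [measure, Measure.smul_apply, smul_eq_mul]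
  exact mul_le_of_le_one_left' (ENNReal.inv_le_one.2 (one_le_rawMeasure_univ hY))

theorem isProbabilityMeasure_measure [IsProbabilityMeasure μ] (hY : ∀ n, MeasurableSet (Y n))
    (hfin : ∑' n, Fintype.card (V n) * μ (Y n) ≠ ∞) :
    IsProbabilityMeasure (measure Y V μ) := by
  refine ⟨?_⟩
  rw [measure, Measure.smul_apply, smul_eq_mul]
  refine ENNReal.inv_mul_cancel (one_pos.trans_le (one_le_rawMeasure_univ hY)).ne' ?_
  rw [rawMeasure_univ hY, measure_univ]
  exact ENNReal.add_ne_top.2 ⟨ENNReal.one_ne_top, hfin⟩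

end Mass

/-! ### Ergodicity -/

section Ergodic

variable {H : SimpleGraph X} {T : ∀ n, SimpleGraph (V n)} {t : ∀ n, V n}

theorem reachable_base {x y : X} (h : H.Reachable x y) :
    (graph Y H T t).Reachable (base x) (base y) :=
  h.map ⟨base, fun h => graph_adj_base_base.2 h⟩

theorem reachable_base_copy (hT : ∀ n p q, (T n).Reachable p q) (n : ℕ) (s : Y n) (p : V n) :
    (graph Y H T t).Reachable (base (s : X)) (copy n s p) := by
  have h1 : (graph Y H T t).Adj (base (s : X)) (copy n s (t n)) := by simp
  exact h1.reachable.trans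
    ((hT n (t n) p).map ⟨copy n s, fun h => graph_adj_copy_copy.2 ⟨rfl, h⟩⟩)

variable [MeasurableSpace X] [∀ n, Fintype (V n)] {μ : Measure X}

theorem measure_eq_zero_of_base (hY : ∀ n, MeasurableSet (Y n)) {A : Set (AttachedSpace Y V)}
    (hA : MeasurableSet A) (hcopy : ∀ n s p, copy n s p ∈ A → base (s : X) ∈ A)
    (h0 : μ (base ⁻¹' A) = 0) : measure Y V μ A = 0 := by
  have hraw : rawMeasure Y V μ A = 0 := by
    rw [rawMeasure_apply μ hY hA, h0, zero_add, ENNReal.tsum_eq_zero]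
    refine fun n => Finset.sum_eq_zero fun p _ => measure_mono_null ?_ h0
    rintro x ⟨hx, hxA⟩
    exact hcopy n ⟨x, hx⟩ p hxA
  rw [measure, Measure.smul_apply, hraw, smul_zero]

/-- Each copy lies in the component of its base point, so an invariant set with null trace on the
base is null; this applies to the set or to its complement. -/
theorem isErgodicGraph_graph (hY : ∀ n, MeasurableSet (Y n)) (hH : IsErgodicGraph H μ)
    (hT : ∀ n p q, (T n).Reachable p q) :
    IsErgodicGraph (graph Y H T t) (measure Y V μ) := by
  intro A hA hinv
  have hiff : ∀ n (s : Y n) p, base (s : X) ∈ A ↔ copy n s p ∈ A :=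
    fun n s p => hinv _ _ (reachable_base_copy hT n s p)
  rcases hH (base ⁻¹' A) (measurable_base hA) fun x y h => hinv _ _ (reachable_base h) with h | h
  · exact .inl (measure_eq_zero_of_base hY hA (fun n s p => (hiff n s p).2) h)
  · exact .inr (measure_eq_zero_of_base hY hA.compl
      (fun n s p hp hs => hp ((hiff n s p).1 hs)) h)

end Ergodic

/-! ### Hyperfiniteness -/

section Hyperfinite

variable {V : ℕ → Type*} {Y : ℕ → Set UnitAddCircle} {α : ℝ}
  {T : ∀ n, SimpleGraph (V n)} {t : ∀ n, V n}

theorem proj_eq_or_of_graph_adj {H : SimpleGraph UnitAddCircle} {z w : AttachedSpace Y V}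
    (h : (graph Y H T t).Adj z w) :
    proj w = proj z ∨ ∃ x y, z = base x ∧ w = base y ∧ H.Adj x y := by
  induction z using rec' with
  | hb x =>
    rcases exists_of_graph_adj_base h with ⟨y, hy, rfl⟩ | ⟨n, hx, rfl⟩
    · exact .inr ⟨x, y, rfl, rfl, hy⟩
    · exact .inl rfl
  | hc n s p =>
    rcases exists_of_graph_adj_copy h with rfl | ⟨q, -, rfl⟩ <;> exact .inl rfl

/-- Within the graph without `S`, the projections of the points of a component lie on an orbit
segment that avoids every `Z` with `base '' Z ⊆ S`. -/
theorem exists_orbit_segment_of_reachable {S : Set (AttachedSpace Y V)}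
    {Z : Set UnitAddCircle} (hZ : base '' Z ⊆ S) {z w : ↑Sᶜ}
    (h : ((graph Y (rotationGraph α) T t).induce Sᶜ).Reachable z w) :
    ∃ k : ℤ, proj w.1 = proj z.1 + k • (α : UnitAddCircle) ∧
      (k = 0 ∨ ∀ j ∈ uIcc 0 k, proj z.1 + j • (α : UnitAddCircle) ∉ Z) := by
  rw [SimpleGraph.reachable_iff_reflTransGen] at h
  induction h with
  | refl => exact ⟨0, by simp, .inl rfl⟩
  | @tail v w _ hvw ih =>
    obtain ⟨k, hk, hZk⟩ := ih
    rcases proj_eq_or_of_graph_adj (SimpleGraph.induce_adj.1 hvw) with h | ⟨x, y, hx, hy, hxy⟩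
    · exact ⟨k, h.trans hk, hZk⟩
    · have hxZ : x ∉ Z := fun h' => v.2 (hx ▸ hZ ⟨x, h', rfl⟩)
      have hyZ : y ∉ Z := fun h' => w.2 (hy ▸ hZ ⟨y, h', rfl⟩)
      rw [hx, proj_base] at hk
      -- The case `k = 0` is separate because a copy over a point of `Z` may survive. Once a base
      -- edge is used, its initial point `x` is a surviving base point, hence outside `Z`.
      have hall : ∀ j ∈ uIcc 0 k, proj z.1 + j • (α : UnitAddCircle) ∉ Z := by
        rcases hZk with rfl | hZk
        · intro j hj
          obtain rfl : j = 0 := by simpa using hj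
          rwa [← hk]
        · exact hZk
      -- The only possible new point of the segment is its end, which is `y`.
      have hstep : ∀ k', (k' = k + 1 ∨ k' = k - 1) →
          y = proj z.1 + k' • (α : UnitAddCircle) →
          ∀ j ∈ uIcc 0 k', proj z.1 + j • (α : UnitAddCircle) ∉ Z := by
        intro k' hk' hyk j hj
        by_cases hjk : j = k'
        · rw [hjk, ← hyk]; exact hyZ
        · refine hall j ?_
          rw [mem_uIcc] at hj ⊢
          omega
      rw [hy, proj_base]
      rcases (rotationGraph_adj.1 hxy).2 with h | h
      · have hyk : y = proj z.1 + (k + 1) • (α : UnitAddCircle) := by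
          rw [h, hk, add_zsmul, one_zsmul, add_assoc]
        exact ⟨k + 1, hyk, .inr (hstep _ (.inl rfl) hyk)⟩
      · have hyk : y = proj z.1 + (k - 1) • (α : UnitAddCircle) := by
          rw [eq_sub_of_add_eq h.symm, hk, sub_zsmul, one_zsmul]; abel
        exact ⟨k - 1, hyk, .inr (hstep _ (.inr rfl) hyk)⟩

/-- The points of `Z ⊆ X` together with all attached copies of level at least `M`. -/
def truncation (Z : Set UnitAddCircle) (M : ℕ) : Set (AttachedSpace Y V) :=
  {z | Sum.elim (fun x => x ∈ Z) (fun w => M ≤ w.1) z}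

@[simp] theorem base_mem_truncation {Z : Set UnitAddCircle} {M : ℕ} {x : UnitAddCircle} :
    (base x : AttachedSpace Y V) ∈ truncation Z M ↔ x ∈ Z := Iff.rfl

@[simp] theorem copy_mem_truncation {Z : Set UnitAddCircle} {M n : ℕ} {s : Y n} {p : V n} :
    copy n s p ∈ truncation Z M ↔ M ≤ n := Iff.rfl

variable [∀ n, Fintype (V n)]

theorem measurableSet_truncation {Z : Set UnitAddCircle} (hZ : MeasurableSet Z) (M : ℕ) :
    MeasurableSet (truncation Z M : Set (AttachedSpace Y V)) :=
  measurableSet_iff.2 ⟨hZ, fun n _ => MeasurableSet.const (M ≤ n)⟩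

theorem rawMeasure_truncation (μ : Measure UnitAddCircle) (hY : ∀ n, MeasurableSet (Y n))
    {Z : Set UnitAddCircle} (hZ : MeasurableSet Z) (M : ℕ) :
    rawMeasure Y V μ (truncation Z M) =
      μ Z + ∑' n, if M ≤ n then Fintype.card (V n) * μ (Y n) else 0 := by
  rw [rawMeasure_apply μ hY (measurableSet_truncation hZ M)]
  congr 2 with n
  split_ifs with h <;> simp [slice, h]

/-- A point of the component of `z` is determined by its orbit offset from `z`, at most `2 * C` in
absolute value, and by its place in the fiber: the base or a vertex of level below `M`. These data
form the finite type `D`. -/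
theorem exists_encard_supp_le {Z : Set UnitAddCircle} {C : ℕ}
    (hC : ∀ x, ∃ y ∈ Z, (rotationGraph α).edist x y ≤ C) (M : ℕ) :
    ∃ K : ℕ, 1 ≤ K ∧ ∀ c : ((graph Y (rotationGraph α) T t).induce
      (truncation Z M)ᶜ).ConnectedComponent, c.supp.encard ≤ K := by
  classical
  let D := ↥(Finset.Icc (-(2 * C : ℤ)) (2 * C)) × Option (Σ n : Fin M, V n)
  have : Nonempty D := ⟨⟨⟨0, by simp⟩, none⟩⟩
  refine ⟨Fintype.card D, Fintype.card_pos, fun c => ?_⟩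
  induction c using SimpleGraph.ConnectedComponent.ind with | _ z
  let g : D → AttachedSpace Y V := fun d =>
    match d.2 with
    | none => base (proj z.1 + (d.1 : ℤ) • (α : UnitAddCircle))
    -- The value `z.1` is a filler for offsets whose point carries no copy of that level.
    | some o => if h : proj z.1 + (d.1 : ℤ) • (α : UnitAddCircle) ∈ Y o.1 then
        copy o.1 ⟨_, h⟩ o.2 else z.1
  have hsub : Subtype.val '' ((graph Y (rotationGraph α) T t).induce
      (truncation Z M)ᶜ |>.connectedComponentMk z).supp ⊆ range g := by
    rintro _ ⟨w, hw, rfl⟩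
    have hreach := (SimpleGraph.ConnectedComponent.exact hw).symm
    obtain ⟨k, hk, hkZ⟩ := exists_orbit_segment_of_reachable (Z := Z)
      (by rintro _ ⟨x, hx, rfl⟩; exact hx) hreach
    have hk2 : |k| ≤ 2 * C := by
      rcases hkZ with rfl | hkZ
      · simp
      · exact abs_le_of_orbit_avoids hC hkZ
    have hkmem : k ∈ Finset.Icc (-(2 * C : ℤ)) (2 * C) := Finset.mem_Icc.2 (abs_le.1 hk2)
    obtain ⟨w, hwS⟩ := w
    induction w using rec' with
    | hb x => exact ⟨(⟨k, hkmem⟩, none), congrArg base hk.symm⟩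
    | hc n s p =>
      have hn : n < M := not_le.1 hwS
      obtain ⟨x, hx⟩ := s
      obtain rfl : x = _ := hk
      exact ⟨(⟨k, hkmem⟩, some ⟨⟨n, hn⟩, p⟩), dif_pos hx⟩
  calc _ = (Subtype.val '' (((graph Y (rotationGraph α) T t).induce
        (truncation Z M)ᶜ).connectedComponentMk z).supp).encard :=
        (Subtype.val_injective.encard_image _).symm
    _ ≤ (range g).encard := encard_le_encard hsub
    _ ≤ (univ : Set D).encard := by rw [← image_univ]; exact encard_image_le _ _
    _ = Fintype.card D := by simp

end Hyperfinite

/-! ### Failure of uniform hyperfiniteness -/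

section Uniform

variable {H : SimpleGraph X} {T : ∀ n, SimpleGraph (V n)} {t : ∀ n, V n}

variable (Y V) in
/-- The union of all attached copies of level `n`. -/
def level (n : ℕ) : Set (AttachedSpace Y V) :=
  {z | ∃ s p, z = copy n s p}

@[simp] theorem base_notMem_level {n : ℕ} {x : X} :
    (base x : AttachedSpace Y V) ∉ level Y V n := by
  simp [level]

@[simp] theorem copy_mem_level {n m : ℕ} {s : Y m} {p : V m} :
    copy m s p ∈ level Y V n ↔ m = n := by
  constructor
  · rintro ⟨_, _, h⟩
    exact eq_of_copy_eq h
  · rintro rfl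
    exact ⟨s, p, rfl⟩

variable [MeasurableSpace X] [∀ n, Fintype (V n)] {μ : Measure X}

theorem measurableSet_level (n : ℕ) : MeasurableSet (level Y V n) :=
  measurableSet_iff.2 ⟨by simp [preimage], fun m _ => by simp [preimage]⟩

theorem rawMeasure_of_subset_level (hY : ∀ n, MeasurableSet (Y n)) {n : ℕ}
    {A : Set (AttachedSpace Y V)} (hA : MeasurableSet A) (hsub : A ⊆ level Y V n) :
    rawMeasure Y V μ A = ∑ p, μ (slice A n p) := by
  have hb : base ⁻¹' A = (∅ : Set X) :=
    eq_empty_of_forall_notMem fun x hx => base_notMem_level (hsub hx)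
  rw [rawMeasure_apply μ hY hA, hb, measure_empty, zero_add, tsum_eq_single n]
  intro m hm
  refine Finset.sum_eq_zero fun p _ => ?_
  have : slice A m p = ∅ :=
    eq_empty_of_forall_notMem fun x ⟨h, hx⟩ => hm (copy_mem_level.1 (hsub hx))
  rw [this, measure_empty]

theorem rawMeasure_level (hY : ∀ n, MeasurableSet (Y n)) (n : ℕ) :
    rawMeasure Y V μ (level Y V n) = Fintype.card (V n) * μ (Y n) := by
  rw [rawMeasure_of_subset_level hY (measurableSet_level n) subset_rfl]
  simp [slice]

open scoped Classical in
/-- A set that contains a large part of every copy of level `n` has large measure. -/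
theorem mul_rawMeasure_level_le (hY : ∀ n, MeasurableSet (Y n)) {n : ℕ}
    {A : Set (AttachedSpace Y V)} (hA : MeasurableSet A) (hsub : A ⊆ level Y V n) {ε : ℝ}
    (hε : ∀ s : Y n, ε * Fintype.card (V n) ≤
      ((Finset.univ.filter fun p => copy n s p ∈ A).card : ℝ)) :
    ENNReal.ofReal ε * rawMeasure Y V μ (level Y V n) ≤ rawMeasure Y V μ A := by
  have hm : ∀ p : V n, Measurable ((slice A n p).indicator (1 : X → ℝ≥0∞)) :=
    fun p => measurable_one.indicator (measurableSet_slice hY hA n p)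
  have hsum : rawMeasure Y V μ A =
      ∫⁻ x, ∑ p : V n, (slice A n p).indicator (1 : X → ℝ≥0∞) x ∂μ := by
    rw [rawMeasure_of_subset_level hY hA hsub, lintegral_finsetSum _ fun p _ => hm p]
    exact Finset.sum_congr rfl fun p _ =>
      (lintegral_indicator_one (measurableSet_slice hY hA n p)).symm
  rw [hsum, rawMeasure_level hY, ← mul_assoc, ← lintegral_indicator_const (hY n)]
  -- Over `x ∈ Y n` the integrand counts the vertices of the copy at `x` in `A`; elsewhere the left
  -- side vanishes.
  refine lintegral_mono fun x => ?_
  by_cases hx : x ∈ Y n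
  · rw [indicator_of_mem hx]
    have h1 : ∑ p : V n, (slice A n p).indicator (1 : X → ℝ≥0∞) x =
        ((Finset.univ.filter fun p => copy n ⟨x, hx⟩ p ∈ A).card : ℝ≥0∞) := by
      rw [Finset.card_filter, Nat.cast_sum]
      refine Finset.sum_congr rfl fun p _ => ?_
      by_cases hp : copy n ⟨x, hx⟩ p ∈ A
      · have : x ∈ slice A n p := ⟨hx, hp⟩
        simp [this, hp]
      · have : x ∉ slice A n p := fun ⟨_, h⟩ => hp h
        simp [this, hp]
    rw [h1, ← ENNReal.ofReal_natCast, ← ENNReal.ofReal_natCast,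
      ← ENNReal.ofReal_mul' (Nat.cast_nonneg _)]
    exact ENNReal.ofReal_le_ofReal (hε ⟨x, hx⟩)
  · rw [indicator_of_notMem hx]
    exact zero_le

open scoped Classical in
/-- If a removed set of a level has small relative measure, then in some copy it has few
vertices. -/
theorem exists_card_lt_of_normalizedRestriction_lt (hY : ∀ n, MeasurableSet (Y n)) {n : ℕ}
    (h0 : measure Y V μ (level Y V n) ≠ 0) (htop : measure Y V μ (level Y V n) ≠ ∞)
    {S : Set (level Y V n)} (hS : MeasurableSet S) {ε : ℝ}
    (hlt : normalizedRestriction (measure Y V μ) (level Y V n) S < ENNReal.ofReal ε) :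
    ∃ s : Y n, ((Finset.univ.filter fun p => copy n s p ∈ Subtype.val '' S).card : ℝ) <
      ε * Fintype.card (V n) := by
  by_contra! hε
  have hle := mul_rawMeasure_level_le (μ := μ) hY
    ((measurableSet_level n).subtype_image hS) (by simp) hε
  have hle' : ENNReal.ofReal ε * measure Y V μ (level Y V n) ≤
      measure Y V μ (Subtype.val '' S) := by
    simp only [measure, Measure.smul_apply, smul_eq_mul]
    rw [mul_left_comm]
    gcongr
  refine absurd hlt (not_lt.2 ?_)
  rw [normalizedRestriction, Measure.smul_apply, smul_eq_mul,
    comap_subtype_coe_apply (measurableSet_level n)]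
  calc ENNReal.ofReal ε = (measure Y V μ (level Y V n))⁻¹ *
        (ENNReal.ofReal ε * measure Y V μ (level Y V n)) := by
        rw [mul_left_comm, ENNReal.inv_mul_cancel h0 htop, mul_one]
    _ ≤ _ := by gcongr

/-- The test sets are the levels: for any `K`, a level whose expanders have at least `4 * K`
vertices violates the bound. -/
theorem not_isMuUniformlyHyperfinite_graph (hY : ∀ n, MeasurableSet (Y n))
    [∀ n, DecidableRel (T n).Adj] (hreg : ∀ n, (T n).IsRegularOfDegree 3)
    (hgrow : StrictMono fun n => Fintype.card (V n)) (hexp : IsExpanderSequence T)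
    (h0 : ∀ n, measure Y V μ (level Y V n) ≠ 0)
    (htop : ∀ n, measure Y V μ (level Y V n) ≠ ∞) :
    ¬ IsMuUniformlyHyperfinite (graph Y H T t) (measure Y V μ) := by
  classical
  intro hunif
  obtain ⟨c, hc, hexp⟩ := hexp
  -- The bound `c / 12` beats the expansion, and `1 / 4` leaves room to enlarge a union of
  -- components.
  obtain ⟨K, -, hK⟩ := hunif (min (c / 12) (1 / 4)) (by positivity)
  -- A strictly increasing sequence of naturals satisfies `n ≤ |V n|`.
  let n := 4 * K
  have hn : 4 * K ≤ Fintype.card (V n) := hgrow.le_apply (x := n)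
  obtain ⟨S, hS, hlt, hcomp⟩ := hK (level Y V n) (measurableSet_level n) (pos_iff_ne_zero.2 (h0 n))
  obtain ⟨s, hs⟩ := exists_card_lt_of_normalizedRestriction_lt hY (h0 n) (htop n) hS hlt
  let R : Finset (V n) := Finset.univ.filter fun p => copy n s p ∈ Subtype.val '' S
  have hcard0 : (0 : ℝ) ≤ Fintype.card (V n) := Nat.cast_nonneg _
  have hR : (R.card : ℝ) < c / 12 * Fintype.card (V n) :=
    hs.trans_le (mul_le_mul_of_nonneg_right (min_le_left _ _) hcard0)
  have hR' : 4 * R.card < Fintype.card (V n) := by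
    have h1 : (R.card : ℝ) < 1 / 4 * Fintype.card (V n) :=
      hs.trans_le (mul_le_mul_of_nonneg_right (min_le_right _ _) hcard0)
    have h2 : (4 * R.card : ℝ) < Fintype.card (V n) := by linarith
    exact_mod_cast h2
  let φ : {p // p ∉ R} → ↑(Sᶜ) := fun p =>
    ⟨⟨copy n s p, copy_mem_level.2 rfl⟩, fun h =>
      p.2 (Finset.mem_filter.2 ⟨Finset.mem_univ _, _, h, rfl⟩)⟩
  refine SimpleGraph.false_of_expansion_of_small_components (hreg n) (hexp n) hc hR hR' hn ?_
  intro v hv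
  let comp := (((graph Y H T t).induce (level Y V n)).induce Sᶜ).connectedComponentMk (φ ⟨v, hv⟩)
  -- The trace on the chosen copy of the component of `v` in the whole remaining level.
  let C : Finset (V n) := Finset.univ.filter fun w => ∃ h : w ∉ R, φ ⟨w, h⟩ ∈ comp.supp
  have hCmem : ∀ w, w ∈ C ↔ ∃ h : w ∉ R, φ ⟨w, h⟩ ∈ comp.supp := fun w =>
    Finset.mem_filter_univ w
  refine ⟨C, (hCmem v).2 ⟨hv, rfl⟩, ?_, ?_, ?_⟩
  · have hinj : Function.Injective (copy n s : V n → AttachedSpace Y V) :=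
      fun p q h => (copy_inj.1 h).2
    have hsub : copy n s '' (C : Set (V n)) ⊆
        (fun z : ↑(Sᶜ) => (z.1.1 : AttachedSpace Y V)) '' comp.supp := by
      rintro _ ⟨w, hw, rfl⟩
      obtain ⟨h, hw⟩ := (hCmem w).1 hw
      exact ⟨_, hw, rfl⟩
    have hle : ((C : Set (V n)).encard) ≤ K := by
      rw [← hinj.encard_image]
      exact (encard_le_encard hsub).trans ((encard_image_le _ _).trans (hcomp comp))
    rw [encard_coe_eq_coe_finsetCard] at hle
    exact_mod_cast hle
  · rw [Finset.disjoint_left]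
    intro w hw
    exact ((hCmem w).1 hw).1
  · intro u hu w hw huw
    obtain ⟨hu, hu'⟩ := (hCmem u).1 hu
    refine (hCmem w).2 ⟨hw, ?_⟩
    have hadj : (((graph Y H T t).induce (level Y V n)).induce Sᶜ).Adj (φ ⟨u, hu⟩) (φ ⟨w, hw⟩) :=
      graph_adj_copy_copy.2 ⟨rfl, huw⟩
    exact (comp.mem_supp_congr_adj hadj).1 hu'

end Uniform

end AttachedSpace

/-! ### Marker sequences -/

theorem isProbabilityMeasure_volume_unitAddCircle :
    IsProbabilityMeasure (volume : Measure UnitAddCircle) :=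
  ⟨UnitAddCircle.measure_univ⟩

/-- Any nonempty open sets are syndetic, so only disjointness and small measure have to be arranged.
-/
theorem exists_isMarkerSequence {α : ℝ} (hα : Irrational α) (V : ℕ → Type*)
    [∀ n, Fintype (V n)] :
    ∃ Y : ℕ → Set UnitAddCircle,
      IsMarkerSequence α V Y ∧ Pairwise fun m n => Disjoint (Y m) (Y n) := by
  obtain ⟨Y, hopen, hne, hvol, hdisj⟩ := exists_disjoint_isOpen_volume_le
    (fun n => ((2 : ℝ≥0∞) ^ (n + 1) * (Fintype.card (V n) : ℝ≥0∞))⁻¹)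
    fun n => ENNReal.inv_pos.2 (ENNReal.mul_ne_top (by finiteness) (by finiteness))
  exact ⟨Y, ⟨fun n => (hopen n).measurableSet,
    fun n => exists_syndetic_of_isOpen hα (hopen n) (hne n), hvol⟩, hdisj⟩

namespace IsMarkerSequence

variable {α : ℝ} {V : ℕ → Type*} [∀ n, Fintype (V n)] {Y : ℕ → Set UnitAddCircle}

theorem card_mul_volume_le (hY : IsMarkerSequence α V Y) (n : ℕ) :
    Fintype.card (V n) * volume (Y n) ≤ 2⁻¹ ^ (n + 1) := by
  -- For empty `V n` the bound on the volume is `0⁻¹ = ∞`, but the product is zero.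
  rcases Nat.eq_zero_or_pos (Fintype.card (V n)) with h | h
  · simp [h]
  · have h' : (Fintype.card (V n) : ℝ≥0∞) ≠ 0 := by exact_mod_cast h.ne'
    refine (mul_le_mul_right (hY.volume_le n) _).trans ?_
    rw [ENNReal.mul_inv (.inr (ENNReal.natCast_ne_top _)) (.inr h'), mul_left_comm,
      ENNReal.mul_inv_cancel h' (ENNReal.natCast_ne_top _), mul_one, ENNReal.inv_pow]

theorem tsum_card_mul_volume_tail_le (hY : IsMarkerSequence α V Y) (M : ℕ) :
    ∑' n, (if M ≤ n then (Fintype.card (V n) : ℝ≥0∞) * volume (Y n) else 0) ≤ 2⁻¹ ^ M := by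
  have h1 : ∑' n, (if M ≤ n then (Fintype.card (V n) : ℝ≥0∞) * volume (Y n) else 0) =
      ∑' n, (Fintype.card (V (n + M)) : ℝ≥0∞) * volume (Y (n + M)) := by
    rw [← (ENNReal.summable).sum_add_tsum_nat_add' (k := M)]
    rw [Finset.sum_eq_zero fun i hi => if_neg (not_le.2 (Finset.mem_range.1 hi)), zero_add]
    simp
  rw [h1]
  calc _ ≤ ∑' n : ℕ, (2⁻¹ : ℝ≥0∞) ^ (n + 1) * 2⁻¹ ^ M :=
        ENNReal.tsum_le_tsum fun n => (hY.card_mul_volume_le (n + M)).trans_eq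
          (by rw [← pow_add]; congr 1; omega)
    _ = 2⁻¹ ^ M := by
        rw [ENNReal.tsum_mul_right]
        simp [ENNReal.tsum_geometric_add_one, ENNReal.inv_mul_cancel]

/-- The same `M` truncates the levels and selects the marker set that cuts the orbits; each of the
two deletions costs at most `2⁻¹ ^ M`. -/
theorem isMuHyperfinite_graph (hY : IsMarkerSequence α V Y) (hV : ∀ n, 0 < Fintype.card (V n))
    (T : ∀ n, SimpleGraph (V n)) (t : ∀ n, V n) :
    IsMuHyperfinite (AttachedSpace.graph Y (rotationGraph α) T t)
      (AttachedSpace.measure Y V volume) := by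
  intro ε hε
  have := isProbabilityMeasure_volume_unitAddCircle
  obtain ⟨M, hM⟩ := ENNReal.exists_inv_two_pow_lt
    (a := ENNReal.ofReal ε / 2) (by simpa using hε)
  obtain ⟨C, -, hC⟩ := hY.syndetic M
  obtain ⟨K, hK1, hK⟩ := AttachedSpace.exists_encard_supp_le (T := T) (t := t) (Y := Y) hC M
  refine ⟨K, hK1, AttachedSpace.truncation (Y M) M,
    AttachedSpace.measurableSet_truncation (hY.measurableSet M) M, ?_, hK⟩
  have hYM : volume (Y M) ≤ 2⁻¹ ^ M := by
    refine le_trans ?_ ((hY.card_mul_volume_le M).trans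
      (pow_le_pow_right_of_le_one' (by simp) M.le_succ))
    exact le_mul_of_one_le_left' (by exact_mod_cast hV M)
  calc _ ≤ _ := AttachedSpace.measure_le_rawMeasure hY.measurableSet _
    _ ≤ 2⁻¹ ^ M + 2⁻¹ ^ M := by
      rw [AttachedSpace.rawMeasure_truncation _ hY.measurableSet (hY.measurableSet M)]
      exact add_le_add hYM (hY.tsum_card_mul_volume_tail_le M)
    _ < ENNReal.ofReal ε / 2 + ENNReal.ofReal ε / 2 := ENNReal.add_lt_add hM hM
    _ = ENNReal.ofReal ε := ENNReal.add_halves _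

end IsMarkerSequence

theorem mainTheorem3 (α : ℝ) (hα : Irrational α)
    (V : ℕ → Type*) [∀ n, Fintype (V n)] (T : ∀ n, SimpleGraph (V n))
    [∀ n, DecidableRel (T n).Adj]
    (hreg : ∀ n, (T n).IsRegularOfDegree 3)
    (hgrow : StrictMono fun n => Fintype.card (V n))
    (hexp : IsExpanderSequence T)
    (t : ∀ n, V n) :
    (∃ Y : ℕ → Set UnitAddCircle,
      IsMarkerSequence α V Y ∧ Pairwise fun m n => Disjoint (Y m) (Y n)) ∧
    ∀ Y : ℕ → Set UnitAddCircle, IsMarkerSequence α V Y →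
      (∃ D : ℕ, ∀ x : UnitAddCircle, {n : ℕ | x ∈ Y n}.encard ≤ D) →
      IsBorelGraph (AttachedSpace.graph Y (rotationGraph α) T t) ∧
      HasBoundedDegrees (AttachedSpace.graph Y (rotationGraph α) T t) ∧
      IsProbabilityMeasure (AttachedSpace.measure Y V (volume : Measure UnitAddCircle)) ∧
      IsInvariantMeasure (AttachedSpace.graph Y (rotationGraph α) T t)
        (AttachedSpace.measure Y V volume) ∧
      IsErgodicGraph (AttachedSpace.graph Y (rotationGraph α) T t)
        (AttachedSpace.measure Y V volume) ∧
      IsMuHyperfinite (AttachedSpace.graph Y (rotationGraph α) T t)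
        (AttachedSpace.measure Y V volume) ∧
      ¬ IsMuUniformlyHyperfinite (AttachedSpace.graph Y (rotationGraph α) T t)
        (AttachedSpace.measure Y V volume) := by
  refine ⟨exists_isMarkerSequence hα V, fun Y hY ⟨D, hD⟩ => ?_⟩
  have := isProbabilityMeasure_volume_unitAddCircle
  have hV : ∀ n, 0 < Fintype.card (V n) := fun n => Fintype.card_pos_iff.2 ⟨t n⟩
  have hreach : ∀ n p q, (T n).Reachable p q := fun n p q => by
    obtain ⟨c, hc, h⟩ := hexp
    exact SimpleGraph.reachable_of_expansion hc (h n) p q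
  -- The tail bound from level `0` on shows that all copies together have mass at most 1.
  have hprob : IsProbabilityMeasure (AttachedSpace.measure Y V (volume : Measure UnitAddCircle)) :=
    AttachedSpace.isProbabilityMeasure_measure hY.measurableSet
      (ne_top_of_le_ne_top ENNReal.one_ne_top
        (by simpa using hY.tsum_card_mul_volume_tail_le 0))
  have hinv : IsInvariantMeasure (AttachedSpace.graph Y (rotationGraph α) T t)
      (AttachedSpace.measure Y V volume) :=
    AttachedSpace.isInvariantMeasure_graph hY.measurableSet
      (g := Equiv.addRight (α : UnitAddCircle))
      (measurePreserving_add_right volume (α : UnitAddCircle))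
      (measurePreserving_add_right volume (-(α : UnitAddCircle)))
      (fun _ _ => rotationGraph_adj) T t
  have := AttachedSpace.standardBorelSpace (V := V) hY.measurableSet
  refine ⟨hinv.isBorelGraph,
    AttachedSpace.hasBoundedDegrees (encard_neighborSet_rotationGraph_le α) (k := 3)
      (fun n p => ?_) hD,
    hprob, hinv,
    AttachedSpace.isErgodicGraph_graph hY.measurableSet (isErgodicGraph_rotationGraph hα) hreach,
    hY.isMuHyperfinite_graph hV T t,
    AttachedSpace.not_isMuUniformlyHyperfinite_graph hY.measurableSet hreg hgrow hexp
      (fun n => ?_) fun n => measure_ne_top _ _⟩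
  · rw [← SimpleGraph.coe_neighborFinset, encard_coe_eq_coe_finsetCard,
      SimpleGraph.card_neighborFinset_eq_degree, hreg n p]
  -- Every level has positive measure because its marker set, being syndetic, has.
  · obtain ⟨C, -, hC⟩ := hY.syndetic n
    have hfin : AttachedSpace.rawMeasure Y V (volume : Measure UnitAddCircle) univ ≠ ∞ := by
      intro h
      have := hprob.measure_univ
      simp [AttachedSpace.measure, h] at this
    rw [AttachedSpace.measure, Measure.smul_apply, smul_eq_mul,
      AttachedSpace.rawMeasure_level hY.measurableSet]
    have h1 : (Fintype.card (V n) : ℝ≥0∞) ≠ 0 := by exact_mod_cast (hV n).ne'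
    exact mul_ne_zero (ENNReal.inv_ne_zero.2 hfin)
      (mul_ne_zero h1 (volume_pos_of_syndetic hC).ne')
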